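/- Let $D=(V,A)$ be a finite digraph (parallel arcs allowed) and let $k$ be a positive integer. For $W\subseteq V$, a spanning arborescence of $D[W]$ is a set of arcs of $D[W]$ that is a spanning tree of $W$ in the undirected sense and in which every node has in-degree at most one; a $k$-arborescence of $D[W]$ is the arc-disjoint union of $k$ spanning arborescences of $D[W]$. For $F\subseteq A$, let $F[W]$ denote the set of arcs of $F$ with both end nodes in $W$. Let $\mathcal{L}\subseteq 2^V$ be a laminar family (any two members are disjoint or one contains the other) with $V\in\mathcal{L}$, and for $W\in\mathcal L$ put $\mathcal{L}[W]=\{W'\in\mathcal{L}: W'\subseteq W\}$. A $k$-arborescence $F$ of $D$ is $\mathcal{L}$-tight if $F[W]$ is a $k$-arborescence of $D[W]$ for every $W\in\mathcal{L}$; a transversal is a set $H\subseteq A$ that meets every $\mathcal{L}$-tight $k$-arborescence of $D$. For $W\in\mathcal{L}$ and $Z\subseteq W$, let $f_W(Z)$ be the number of arcs of $D[W]$ that enter $Z$ and do not leave any $W'\in\mathcal{L}[W]$ with $W'\cap Z\neq\emptyset$. Assume that an $\mathcal{L}$-tight $k$-arborescence exists in $D$, and let $\gamma$ be the minimum size of a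 transversal (so that, in particular, a transversal exists). If $\gamma\ge k$, then \[ \gamma=\min\{\, f_W(Z_1)+f_W(Z_2)-k+1 \;:\; W\in\mathcal{L},\ Z_1,Z_2 \text{ disjoint non-empty subsets of } W \,\}. \] -/

import Mathlib

/-- A directed multigraph on node set `V` with arc set `A` (parallel arcs and loops allowed). -/
structure MultiDigraph (V A : Type*) where
  tail : A → V
  head : A → V

namespace MultiDigraph

variable {V A : Type*} (D : MultiDigraph V A)

/-- The simple graph underlying `(W, F)` in the undirected sense: two distinct nodes of `W` are
adjacent if some arc of `F` joins them, in either direction. -/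
def underlying (W : Finset V) (F : Finset A) : SimpleGraph {v : V // v ∈ W} where
  Adj u v := u ≠ v ∧ ∃ e ∈ F, (D.tail e = u.1 ∧ D.head e = v.1) ∨ (D.tail e = v.1 ∧ D.head e = u.1)
  symm := ⟨fun _ _ ⟨hne, e, he, h⟩ => ⟨hne.symm, e, he, h.symm⟩⟩
  loopless := ⟨fun _ h => h.1 rfl⟩

/-- `F` is a spanning tree of the node set `W` in the undirected sense: all arcs lie inside `W`,
there are no loops and no two arcs joining the same pair of nodes (in any directions), and the
underlying simple graph on `W` is a tree. -/
structure IsSpanningTree (W : Finset V) (F : Finset A) : Prop where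
  inside : ∀ e ∈ F, D.tail e ∈ W ∧ D.head e ∈ W
  noLoop : ∀ e ∈ F, D.tail e ≠ D.head e
  noParallel : Set.InjOn (fun e => s(D.tail e, D.head e)) (F : Set A)
  isTree : (D.underlying W F).IsTree

variable [DecidableEq V]

/-- `F` is a spanning arborescence on the node set `W`: a spanning tree in the undirected sense
such that every node has in-degree at most one. -/
def IsArborescence (W : Finset V) (F : Finset A) : Prop :=
  D.IsSpanningTree W F ∧ ∀ v ∈ W, (F.filter fun e => D.head e = v).card ≤ 1

/-- `F` is a `k`-arborescence on the node set `W`: the arc-disjoint union of `k` spanning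
arborescences of `W`. -/
def IsKArborescence [DecidableEq A] (k : ℕ) (W : Finset V) (F : Finset A) : Prop :=
  ∃ P : Fin k → Finset A, (∀ i, D.IsArborescence W (P i)) ∧
    (∀ i j, i ≠ j → Disjoint (P i) (P j)) ∧ F = Finset.univ.biUnion P

/-- The arcs `F[W]` of `F` with both end nodes in `W`. -/
def induced (F : Finset A) (W : Finset V) : Finset A :=
  F.filter fun e => D.tail e ∈ W ∧ D.head e ∈ W

/-- `F` is an `L`-tight `k`-arborescence of `D`. -/
def IsTight [Fintype V] [DecidableEq A] (L : Finset (Finset V)) (k : ℕ) (F : Finset A) : Prop :=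
  D.IsKArborescence k Finset.univ F ∧ ∀ W ∈ L, D.IsKArborescence k W (D.induced F W)

/-- `H` is a transversal of the family of `L`-tight `k`-arborescences of `D`. -/
def IsTransversal [Fintype V] [DecidableEq A] (L : Finset (Finset V)) (k : ℕ) (H : Finset A) :
    Prop :=
  ∀ F : Finset A, D.IsTight L k F → (F ∩ H).Nonempty

/-- `e` enters the node set `Z`. -/
def Enters (e : A) (Z : Finset V) : Prop := D.tail e ∉ Z ∧ D.head e ∈ Z

/-- `e` leaves the node set `Z`. -/
def Leaves (e : A) (Z : Finset V) : Prop := D.tail e ∈ Z ∧ D.head e ∉ Z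

instance (e : A) (Z : Finset V) : Decidable (D.Enters e Z) := inferInstanceAs (Decidable (_ ∧ _))

instance (e : A) (Z : Finset V) : Decidable (D.Leaves e Z) := inferInstanceAs (Decidable (_ ∧ _))

/-- `f_W(Z)`: the number of arcs of `D[W]` that enter `Z` and do not leave any member of
`L[W] = {W' ∈ L : W' ⊆ W}` that meets `Z`. -/
def f [Fintype A] (L : Finset (Finset V)) (W Z : Finset V) : ℕ :=
  ((D.induced Finset.univ W).filter fun e =>
    D.Enters e Z ∧ ∀ W' ∈ L, W' ⊆ W → (W' ∩ Z).Nonempty → ¬ D.Leaves e W').card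

end MultiDigraph

/-- A family of sets is laminar if any two members are disjoint or one contains the other. -/
def IsLaminar {V : Type*} (L : Finset (Finset V)) : Prop :=
  ∀ X ∈ L, ∀ Y ∈ L, Disjoint X Y ∨ X ⊆ Y ∨ Y ⊆ X

/-! One inequality is a count. A `k`-arborescence on `W` has `k(|W| - 1)` arcs, and a nonempty `U ⊆
W` spans at most `k(|U| - 1)` of them. Recursing along the laminar family, with all singletons
added, shows that at most `k(|Z| - 1)` arcs of `F[W]` with head in `Z` escape the count `f_W(Z)`
(`card_not_counted_add_le`). Since in-degrees are at most `k`, a tight `F` contains at least `k`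
arcs counted for `Z₁` or `Z₂` (`IsTight.le_card_counted`). Hence all but `k - 1` of the counted arcs
form a transversal.

For the converse, let `f_W(Z₁) + f_W(Z₂) ≥ k + γ` for all admissible triples and let `|H| ≤ γ`. A
tight `k`-arborescence avoiding `H` is built from the bottom of the laminar family upwards. Each
member `W` carries a supermodular lower bound `p_W` such that every root vector `m ≥ p_W` with `m(W)
= k` is realized by arcs of `D[W]` outside `H` (`IsRealizableBound`).

To pass from the children of `W` to `W`, the demands indexed by `(X, Z)`, with `X` a set of children
and `Z` inside their union, combine the cut conditions between children with the bounds `p_j` on the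
root vectors the children receive. A minimal arc set meeting all demands supplies each child with
exactly `k` entering arcs and roots (`exists_subset_meetsDemand`), and then the solutions of the
children glue (`realizable_of_children`). The unmet demand is intersecting supermodular, so the
vectors dominating it have a fully supermodular lower bound (`exists_isRootBound`), provided that
the unmet demands of disjoint sets sum to at most `k`.

That proviso is where `γ ≥ k` enters. A positive unmet demand of `T` is at most `k - f_W(Q)` plus
the number of arcs of `H` in `D[W]` with head in `T`, for some nonempty `Q ⊆ T`. Two disjoint such
`Q` have `f`-values summing to at least `k + γ ≥ 2k`, so at most one of them is below `k`
(`exists_sum_le`). At the top, Edmonds' theorem turns the cut conditions into `k`-arborescences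
(`isKArborescence_of_cut`). -/

set_option linter.unusedSectionVars false

/-! ### Edmonds' disjoint arborescences theorem with a prescribed root vector. -/

namespace MultiDigraph

variable {V A : Type*} {D : MultiDigraph V A}

/-- The edge of the underlying simple graph given by an arc lying inside `W`. -/
def edgeOf (D : MultiDigraph V A) (W : Finset V) (F : Finset A)
    (hF : ∀ e ∈ F, D.tail e ∈ W ∧ D.head e ∈ W) (e : {e // e ∈ F}) : Sym2 {v : V // v ∈ W} :=
  s(⟨D.tail e.1, (hF e.1 e.2).1⟩, ⟨D.head e.1, (hF e.1 e.2).2⟩)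

theorem edgeSet_underlying {W : Finset V} {F : Finset A}
    (hF : ∀ e ∈ F, D.tail e ∈ W ∧ D.head e ∈ W) (hl : ∀ e ∈ F, D.tail e ≠ D.head e) :
    (D.underlying W F).edgeSet = Set.range (D.edgeOf W F hF) := by
  ext x
  induction x using Sym2.ind with
  | _ u v =>
    simp only [SimpleGraph.mem_edgeSet, Set.mem_range, edgeOf, underlying, Sym2.eq_iff]
    constructor
    · rintro ⟨-, e, he, h | h⟩
      · exact ⟨⟨e, he⟩, Or.inl ⟨Subtype.ext h.1, Subtype.ext h.2⟩⟩
      · exact ⟨⟨e, he⟩, Or.inr ⟨Subtype.ext h.1, Subtype.ext h.2⟩⟩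
    · rintro ⟨⟨e, he⟩, ⟨rfl, rfl⟩ | ⟨rfl, rfl⟩⟩
      · exact ⟨fun h => hl e he (congrArg Subtype.val h), e, he, Or.inl ⟨rfl, rfl⟩⟩
      · exact ⟨fun h => hl e he (congrArg Subtype.val h).symm, e, he, Or.inr ⟨rfl, rfl⟩⟩

variable [DecidableEq V]

/-- The number of arcs of `F` entering `Z`. -/
def inDeg (D : MultiDigraph V A) (F : Finset A) (Z : Finset V) : ℕ := 
  (F.filter fun e => D.Enters e Z).card

theorem inDeg_inter_add_inDeg_union_le (F : Finset A) (X Y : Finset V) :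
    D.inDeg F (X ∩ Y) + D.inDeg F (X ∪ Y) ≤ D.inDeg F X + D.inDeg F Y := by
  simp only [inDeg, Finset.card_filter, ← Finset.sum_add_distrib]
  refine Finset.sum_le_sum fun e _ => ?_
  simp only [Enters, Finset.mem_inter, Finset.mem_union]
  by_cases h1 : D.tail e ∈ X <;> by_cases h2 : D.tail e ∈ Y <;>
    by_cases h3 : D.head e ∈ X <;> by_cases h4 : D.head e ∈ Y <;> simp [h1, h2, h3, h4]

/-- A directed tree with root `r` and node set `U`, described by in-degrees and cuts. -/
structure IsBranching (D : MultiDigraph V A) (r : V) (U : Finset V) (P : Finset A) : Prop where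
  root_mem : r ∈ U
  inside : ∀ e ∈ P, D.tail e ∈ U ∧ D.head e ∈ U
  indeg : ∀ v ∈ U, (P.filter fun e => D.head e = v).card = if v = r then 0 else 1
  cut : ∀ Z ⊆ U, Z.Nonempty → r ∉ Z → ∃ e ∈ P, D.Enters e Z

theorem IsBranching.card_add_one {r : V} {U : Finset V} {P : Finset A}
    (h : D.IsBranching r U P) : P.card + 1 = U.card := by
  have h1 : P.card = ∑ v ∈ U, (P.filter fun e => D.head e = v).card :=
    Finset.card_eq_sum_card_fiberwise fun e he => (h.inside e he).2
  rw [h1, Finset.sum_congr rfl h.indeg, ← Finset.add_sum_erase _ _ h.root_mem]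
  have h2 : ∀ v ∈ U.erase r, (if v = r then 0 else 1) = 1 := by
    intro v hv
    simp [Finset.ne_of_mem_erase hv]
  rw [Finset.sum_congr rfl h2]
  simp [Finset.card_erase_add_one h.root_mem]

/-- A loop at a non-root `v` would be the only arc with head `v`, yet the cut condition needs an arc
entering `{v}`; the root is the head of no arc. -/
theorem IsBranching.tail_ne_head {r : V} {U : Finset V} {P : Finset A}
    (h : D.IsBranching r U P) {e : A} (he : e ∈ P) : D.tail e ≠ D.head e := by
  intro heq
  have hU := (h.inside e he).2
  have hdeg := h.indeg _ hU
  have hmem : e ∈ P.filter fun e' => D.head e' = D.head e := by simp [he]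
  split_ifs at hdeg with hr
  · simp [Finset.card_eq_zero.mp hdeg] at hmem
  · obtain ⟨e', he', hent⟩ := h.cut {D.head e} (by simpa using hU) (by simp)
      (by simpa using fun h' => hr h'.symm)
    simp only [Enters, Finset.mem_singleton] at hent
    have := Finset.card_le_one.mp hdeg.le e hmem e' (by simp [he', hent.2])
    exact hent.1 (this ▸ heq)

/-- The set of nodes not reachable from `r` would be entered by an arc, whose tail is reachable. -/
theorem IsBranching.connected {r : V} {U : Finset V} {P : Finset A}
    (h : D.IsBranching r U P) : (D.underlying U P).Connected := by
  classical
  have key : ∀ v : {v : V // v ∈ U}, (D.underlying U P).Reachable ⟨r, h.root_mem⟩ v := by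
    by_contra hcon
    push Not at hcon
    obtain ⟨v, hv⟩ := hcon
    let Z : Finset V := U.filter fun x =>
      ∃ hx : x ∈ U, ¬ (D.underlying U P).Reachable ⟨r, h.root_mem⟩ ⟨x, hx⟩
    have hZ : Z ⊆ U := Finset.filter_subset _ _
    obtain ⟨e, he, hent⟩ := h.cut Z hZ ⟨v, by simp only [Z, Finset.mem_filter]; exact ⟨v.2, v.2, hv⟩⟩
      (by
        simp only [Z, Finset.mem_filter, not_and, not_exists, not_not]
        intro hr _
        exact SimpleGraph.Reachable.refl _)
    have hin := h.inside e he
    obtain ⟨ht, hh⟩ := hent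
    simp only [Z, Finset.mem_filter, not_and, not_exists, not_not] at ht hh
    obtain ⟨hh1, hh2, hh3⟩ := hh
    apply hh3
    refine (ht hin.1 hin.1).trans (SimpleGraph.Adj.reachable ⟨?_, e, he, Or.inl ⟨rfl, rfl⟩⟩)
    intro heq
    exact h.tail_ne_head he (congrArg Subtype.val heq)
  have : Nonempty {v : V // v ∈ U} := ⟨⟨r, h.root_mem⟩⟩
  exact ⟨fun a b => (key a).symm.trans (key b)⟩

/-- Connectedness needs at least `|U| - 1` edges and there are only `|U| - 1` arcs. So distinct arcs
give distinct edges and the graph is a tree. -/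
theorem IsBranching.isArborescence {r : V} {U : Finset V} {P : Finset A}
    (h : D.IsBranching r U P) : D.IsArborescence U P := by
  classical
  have hl : ∀ e ∈ P, D.tail e ≠ D.head e := fun e he => h.tail_ne_head he
  have hE := edgeSet_underlying h.inside hl
  have hcard : Nat.card (D.underlying U P).edgeSet ≤ P.card := by
    rw [hE]
    calc Nat.card (Set.range (D.edgeOf U P h.inside)) ≤ Nat.card {e // e ∈ P} :=
          Finite.card_range_le _
      _ = P.card := by simp
  have hconn := h.connected
  have hle := hconn.card_vert_le_card_edgeSet_add_one
  have hU : Nat.card {v : V // v ∈ U} = U.card := by simp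
  have hc := h.card_add_one
  refine ⟨⟨h.inside, hl, ?_, ?_⟩, ?_⟩
  · have hinj : Function.Injective (D.edgeOf U P h.inside) := by
      have h2 : Nat.card (Set.range (D.edgeOf U P h.inside)) = Nat.card {e // e ∈ P} := by
        rw [← hE]; simp; simp at hle hcard; omega
      have h3 := Set.rangeFactorization_surjective (f := D.edgeOf U P h.inside)
      have h4 := (Nat.bijective_iff_surjective_and_card _).mpr ⟨h3, h2.symm⟩
      exact Set.rangeFactorization_injective.mp h4.1
    intro a ha b hb hab
    have : D.edgeOf U P h.inside ⟨a, ha⟩ = D.edgeOf U P h.inside ⟨b, hb⟩ := by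
      apply Sym2.map.injective Subtype.val_injective
      exact hab
    exact congrArg Subtype.val (hinj this)
  · rw [SimpleGraph.isTree_iff_connected_and_card]
    exact ⟨hconn, by omega⟩
  · intro v hv
    rw [h.indeg v hv]
    split_ifs <;> simp

variable [DecidableEq A]

/-- One branching can be split off so that the remaining arcs keep their cut condition. -/
theorem exists_branching_of_cut {W : Finset V} {F : Finset A} {m : V → ℕ} {k : ℕ} {r : V}
    (hin : ∀ e ∈ F, D.tail e ∈ W ∧ D.head e ∈ W) (hr : r ∈ W)
    (hcut : ∀ Z ⊆ W, Z.Nonempty → k + 1 ≤ D.inDeg F Z + (∑ v ∈ Z, m v + if r ∈ Z then 1 else 0))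
    (hm : ∑ v ∈ W, m v = k) :
    ∃ P ⊆ F, D.IsBranching r W P ∧
      ∀ Z ⊆ W, Z.Nonempty → k ≤ D.inDeg (F \ P) Z + ∑ v ∈ Z, m v := by
  -- a largest partial branching that preserves the cut condition
  suffices H : ∀ n, ∀ U ⊆ W, ∀ P ⊆ F, (W \ U).card = n → D.IsBranching r U P →
      (∀ Z ⊆ W, Z.Nonempty → k ≤ D.inDeg (F \ P) Z + ∑ v ∈ Z, m v) →
      ∃ P ⊆ F, D.IsBranching r W P ∧
        ∀ Z ⊆ W, Z.Nonempty → k ≤ D.inDeg (F \ P) Z + ∑ v ∈ Z, m v by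
    refine H _ {r} (by simpa using hr) ∅ (by simp) rfl ⟨by simp, by simp, by simp, ?_⟩ ?_
    · intro Z hZ hne hrZ
      obtain ⟨z, hz⟩ := hne
      have := Finset.mem_singleton.mp (hZ hz)
      exact absurd (this ▸ hz) hrZ
    · intro Z hZ hne
      have := hcut Z hZ hne
      rw [Finset.sdiff_empty]
      split_ifs at this <;> omega
  intro n
  induction n with
  | zero =>
    intro U hU P hP hcard hb hc
    have : W ⊆ U := Finset.sdiff_eq_empty_iff_subset.mp (Finset.card_eq_zero.mp hcard)
    have hUW : U = W := hU.antisymm this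
    exact ⟨P, hP, hUW ▸ hb, hc⟩
  | succ n ih =>
    intro U hU P hP hcard hb hc
    -- Lovász's argument: sets not inside `U` whose cut condition is tight obstruct the growth of
    -- `P`. The whole of `W` is one, and the next arc is sought inside a smallest one.
    let crit : Finset (Finset V) := W.powerset.filter fun Z =>
      (Z \ U).Nonempty ∧ D.inDeg (F \ P) Z + ∑ v ∈ Z, m v = k
    have hWc : W ∈ crit := by
      simp only [crit, Finset.mem_filter, Finset.mem_powerset]
      refine ⟨Finset.Subset.refl _, Finset.card_pos.mp (by omega), ?_⟩
      have : D.inDeg (F \ P) W = 0 := by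
        rw [inDeg, Finset.card_eq_zero, Finset.filter_eq_empty_iff]
        intro e he h'
        exact h'.1 (hin e (Finset.mem_sdiff.mp he).1).1
      omega
    obtain ⟨Z, hZc, hZmin⟩ := Finset.exists_min_image crit Finset.card ⟨W, hWc⟩
    simp only [crit, Finset.mem_filter, Finset.mem_powerset] at hZc
    obtain ⟨hZW, hZU, hZk⟩ := hZc
    -- an arc from `Z ∩ U` to `Z \ U`
    obtain ⟨e, heF, het, heh⟩ : ∃ e ∈ F \ P, D.tail e ∈ Z ∩ U ∧ D.head e ∈ Z \ U := by
      by_contra hno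
      push Not at hno
      -- Without such an arc, every arc of `F` entering `Z \ U` enters `Z` and is outside `P`. As `r
      -- ∉ Z \ U`, the bound `k + 1` in `hcut` then contradicts the tightness of `Z`.
      have h1 := hcut (Z \ U) (Finset.sdiff_subset.trans hZW) hZU
      have h2 : D.inDeg F (Z \ U) ≤ D.inDeg (F \ P) Z := by
        refine Finset.card_le_card fun e he => ?_
        rw [Finset.mem_filter] at he ⊢
        simp only [Enters, Finset.mem_sdiff] at he ⊢
        have heP : e ∉ P := fun h' => he.2.2.2 (hb.inside e h').2
        refine ⟨⟨he.1, heP⟩, ?_, he.2.2.1⟩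
        intro htZ
        have htU : D.tail e ∈ U := by
          by_contra h'
          exact he.2.1 ⟨htZ, h'⟩
        exact hno e (by simp [he.1, heP]) (by simp [htZ, htU]) (by simp [he.2.2])
      have h3 : ∑ v ∈ Z \ U, m v ≤ ∑ v ∈ Z, m v :=
        Finset.sum_le_sum_of_subset Finset.sdiff_subset
      have h4 : r ∉ Z \ U := by simp [hb.root_mem]
      rw [if_neg h4] at h1
      omega
    rw [Finset.mem_sdiff] at heF heh
    rw [Finset.mem_inter] at het
    have hhW := (hin e heF.1).2
    refine ih (insert (D.head e) U) (Finset.insert_subset hhW hU) (insert e P)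
      (Finset.insert_subset heF.1 hP) ?_ ?_ ?_
    · rw [Finset.sdiff_insert, Finset.card_erase_of_mem (by simp [hhW, heh.2]), hcard]
      rfl
    · refine ⟨by simp [hb.root_mem], ?_, ?_, ?_⟩
      · intro e' he'
        rcases Finset.mem_insert.mp he' with rfl | he'
        · simp [het.2]
        · simp [hb.inside e' he']
      · intro v hv
        rcases Finset.mem_insert.mp hv with rfl | hv
        · have hne : D.head e ≠ r := fun h' => heh.2 (h' ▸ hb.root_mem)
          rw [if_neg hne, Finset.card_eq_one]
          refine ⟨e, ?_⟩
          ext e'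
          simp only [Finset.mem_filter, Finset.mem_insert, Finset.mem_singleton]
          constructor
          · rintro ⟨rfl | h', h''⟩
            · rfl
            · exact absurd (h'' ▸ (hb.inside e' h').2) heh.2
          · rintro rfl
            simp
        · have hne : D.head e ≠ v := fun h' => heh.2 (h' ▸ hv)
          rw [Finset.filter_insert, if_neg hne]
          exact hb.indeg v hv
      · intro Y hY hYne hrY
        by_cases h' : (Y ∩ U).Nonempty
        · obtain ⟨e', he', hent⟩ := hb.cut (Y ∩ U) Finset.inter_subset_right h' (by simp [hrY])
          refine ⟨e', Finset.mem_insert_of_mem he', ?_⟩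
          simp only [Enters, Finset.mem_inter] at hent ⊢
          exact ⟨fun h'' => hent.1 ⟨h'', (hb.inside e' he').1⟩, hent.2.1⟩
        · rw [Finset.not_nonempty_iff_eq_empty] at h'
          have hYU : ∀ y ∈ Y, y ∉ U := fun y hy hyU => by
            have : y ∈ Y ∩ U := by simp [hy, hyU]
            simp [h'] at this
          obtain ⟨y, hy⟩ := hYne
          have : y = D.head e := by
            rcases Finset.mem_insert.mp (hY hy) with h'' | h''
            · exact h''
            · exact absurd h'' (hYU y hy)
          exact ⟨e, by simp, fun h'' => hYU _ h'' het.2, this ▸ hy⟩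
    · intro Y hY hYne
      have hYc := hc Y hY hYne
      have herase : F \ insert e P = (F \ P).erase e := by
        ext x; simp only [Finset.mem_sdiff, Finset.mem_insert, Finset.mem_erase]; tauto
      have hY1 : D.inDeg (F \ P) Y ≤ D.inDeg ((F \ P).erase e) Y + if D.Enters e Y then 1 else 0 := by
        simp only [inDeg, Finset.filter_erase]
        split_ifs with hent
        · rw [Finset.card_erase_add_one]
          simp [heF, hent]
        · rw [Finset.erase_eq_of_notMem]
          · omega
          · simp [hent]
      rw [herase]
      by_cases hent : D.Enters e Y
      swap
      · rw [if_neg hent] at hY1; omega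
      rw [if_pos hent] at hY1
      by_contra hlt
      have hYk : D.inDeg (F \ P) Y + ∑ v ∈ Y, m v = k := by omega
      -- If adding `e` violated the condition at `Y`, then `Y` was tight; uncrossing makes `Z ∩ Y`
      -- tight. It contains the head of `e` but not its tail, against the minimality of `Z`.
      have hsub := D.inDeg_inter_add_inDeg_union_le (F \ P) Z Y
      have hmod := Finset.sum_union_inter (s₁ := Z) (s₂ := Y) (f := m)
      have hI := hc (Z ∩ Y) (Finset.inter_subset_left.trans hZW) ⟨D.head e, by simp [heh.1, hent.2]⟩
      have hUn := hc (Z ∪ Y) (Finset.union_subset hZW hY) ⟨D.head e, by simp [heh.1]⟩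
      have hmem : Z ∩ Y ∈ crit := by
        simp only [crit, Finset.mem_filter, Finset.mem_powerset]
        exact ⟨Finset.inter_subset_left.trans hZW, ⟨D.head e, by simp [heh, hent.2]⟩, by omega⟩
      have hlt' : (Z ∩ Y).card < Z.card := by
        refine Finset.card_lt_card (Finset.ssubset_iff_of_subset Finset.inter_subset_left |>.mpr
          ⟨D.tail e, het.1, ?_⟩)
        simp [hent.1]
      exact absurd (hZmin _ hmem) (by omega)

/-- Edmonds' theorem on disjoint arborescences, with prescribed root vector `m`. -/
theorem isKArborescence_of_cut {W : Finset V} {k : ℕ} : ∀ {F : Finset A} {m : V → ℕ},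
    (∀ e ∈ F, D.tail e ∈ W ∧ D.head e ∈ W) →
    (∀ v ∈ W, (F.filter fun e => D.head e = v).card + m v = k) →
    (∀ Z ⊆ W, Z.Nonempty → k ≤ D.inDeg F Z + ∑ v ∈ Z, m v) →
    ∑ v ∈ W, m v = k → D.IsKArborescence k W F := by
  induction k with
  | zero =>
    intro F m hin hdeg _ _
    refine ⟨fun i => i.elim0, fun i => i.elim0, fun i => i.elim0, ?_⟩
    have : F = ∅ := by
      by_contra hne
      obtain ⟨e, he⟩ := Finset.nonempty_iff_ne_empty.mpr hne
      have h1 := hdeg _ (hin e he).2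
      have h2 : (F.filter fun e' => D.head e' = D.head e).card = 0 := by omega
      rw [Finset.card_eq_zero, Finset.filter_eq_empty_iff] at h2
      exact h2 he rfl
    simp [this]
  | succ k ih =>
    intro F m hin hdeg hcut hm
    obtain ⟨r, hr, hmr⟩ : ∃ r ∈ W, 0 < m r := by
      by_contra hno
      push Not at hno
      have : ∑ v ∈ W, m v = 0 := Finset.sum_eq_zero fun v hv => Nat.le_zero.mp (hno v hv)
      omega
    let m' : V → ℕ := fun v => m v - if v = r then 1 else 0
    have hmm' : ∀ v, m v = m' v + if v = r then 1 else 0 := by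
      intro v
      simp only [m']
      split_ifs with h
      · subst h; omega
      · omega
    have hsum : ∀ Z : Finset V, ∑ v ∈ Z, m v = ∑ v ∈ Z, m' v + if r ∈ Z then 1 else 0 := by
      intro Z
      rw [Finset.sum_congr rfl fun v _ => hmm' v, Finset.sum_add_distrib]
      simp
    have hm' : ∑ v ∈ W, m' v = k := by
      have := hsum W
      rw [if_pos hr] at this
      omega
    obtain ⟨P, hPF, hP, hPc⟩ := exists_branching_of_cut (m := m') hin hr
      (fun Z hZ hne => by have := hcut Z hZ hne; rw [hsum] at this; exact this) hm'
    obtain ⟨Q, hQ, hQd, hQu⟩ := ih (F := F \ P) (m := m')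
      (fun e he => hin e (Finset.mem_sdiff.mp he).1)
      (by
        intro v hv
        have h1 := hdeg v hv
        have h2 := hP.indeg v hv
        have h3 := hmm' v
        have h4 : ((F \ P).filter fun e => D.head e = v).card +
            (P.filter fun e => D.head e = v).card = (F.filter fun e => D.head e = v).card := by
          rw [← Finset.card_union_of_disjoint
            (Finset.disjoint_filter_filter Finset.sdiff_disjoint), ← Finset.filter_union,
            Finset.sdiff_union_of_subset hPF]
        split_ifs at h2 h3 <;> omega)
      hPc hm'
    refine ⟨Fin.cons P Q, ?_, ?_, ?_⟩
    · intro i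
      refine Fin.cases ?_ (fun i => ?_) i
      · exact hP.isArborescence
      · exact hQ i
    · have hd : ∀ i, Disjoint P (Q i) := fun i => by
        have : Q i ⊆ F \ P := hQu ▸ Finset.subset_biUnion_of_mem Q (Finset.mem_univ i)
        exact Finset.disjoint_of_subset_right this Finset.disjoint_sdiff
      intro i j
      refine Fin.cases ?_ (fun i => ?_) i <;> refine Fin.cases ?_ (fun j => ?_) j
      · simp
      · intro _; exact hd j
      · intro _; exact (hd i).symm
      · intro hij; exact hQd i j fun h => hij (h ▸ rfl)
    · ext e
      have : e ∈ F \ P ↔ ∃ i, e ∈ Q i := by rw [hQu]; simp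
      simp only [Finset.mem_biUnion, Finset.mem_univ, true_and, Fin.exists_fin_succ, Fin.cons_zero,
        Fin.cons_succ, ← this, Finset.mem_sdiff]
      by_cases h : e ∈ P
      · simp [h, hPF h]
      · simp [h]

end MultiDigraph

/-! ### Sparsity of `k`-arborescences. -/

namespace MultiDigraph

variable {V A : Type*} {D : MultiDigraph V A}

theorem card_edgeSet_underlying {W : Finset V} {F : Finset A}
    (hin : ∀ e ∈ F, D.tail e ∈ W ∧ D.head e ∈ W) (hl : ∀ e ∈ F, D.tail e ≠ D.head e)
    (hinj : Set.InjOn (fun e => s(D.tail e, D.head e)) (F : Set A)) :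
    Nat.card (D.underlying W F).edgeSet = F.card := by
  rw [edgeSet_underlying hin hl, Nat.card_range_of_injective]
  · simp
  · intro a b hab
    exact Subtype.ext (hinj a.2 b.2 (congrArg (Sym2.map Subtype.val) hab))

/-- A forest extends to a spanning tree of the complete graph. -/
theorem _root_.SimpleGraph.IsAcyclic.card_edgeSet_add_one_le {U : Type*} [Finite U] [Nonempty U]
    {G : SimpleGraph U} (h : G.IsAcyclic) : Nat.card G.edgeSet + 1 ≤ Nat.card U := by
  obtain ⟨T, hGT, -, hT⟩ :=
    (SimpleGraph.connected_top (V := U)).exists_isTree_le_of_le_of_isAcyclic le_top h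
  rw [← (SimpleGraph.isTree_iff_connected_and_card.mp hT).2]
  exact Nat.add_le_add_right
    (Nat.card_mono (Set.toFinite _) (SimpleGraph.edgeSet_subset_edgeSet.mpr hGT)) 1

theorem IsSpanningTree.card_add_one {W : Finset V} {P : Finset A} (h : D.IsSpanningTree W P) :
    P.card + 1 = W.card := by
  have h1 := (SimpleGraph.isTree_iff_connected_and_card.mp h.isTree).2
  rw [card_edgeSet_underlying h.inside h.noLoop h.noParallel] at h1
  simpa using h1

variable [DecidableEq V]

theorem IsSpanningTree.card_induced_add_one_le {W U : Finset V} {P : Finset A}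
    (h : D.IsSpanningTree W P) (hU : U ⊆ W) (hne : U.Nonempty) :
    (D.induced P U).card + 1 ≤ U.card := by
  have hsub : D.induced P U ⊆ P := Finset.filter_subset _ _
  have hac : (D.underlying U (D.induced P U)).IsAcyclic := by
    let g : D.underlying U (D.induced P U) →g D.underlying W P :=
      ⟨fun v => ⟨v.1, hU v.2⟩, by
        rintro u v ⟨hne, e, he, h'⟩
        exact ⟨fun h'' => hne (Subtype.ext (Subtype.mk.inj h'')), e, hsub he, h'⟩⟩
    refine h.isTree.isAcyclic.comap g fun u v huv => Subtype.ext (Subtype.mk.inj huv)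
  have : Nonempty {v : V // v ∈ U} := hne.to_subtype
  have h1 := hac.card_edgeSet_add_one_le
  rw [card_edgeSet_underlying (F := D.induced P U) (fun e he => (Finset.mem_filter.mp he).2)
    (fun e he => h.noLoop e (hsub he)) (h.noParallel.mono (by exact_mod_cast hsub))] at h1
  simpa using h1

section KArborescence

variable [DecidableEq A] {k : ℕ} {W : Finset V} {F : Finset A}

theorem IsKArborescence.card_add (h : D.IsKArborescence k W F) : F.card + k = k * W.card := by
  obtain ⟨P, hP, hd, rfl⟩ := h
  rw [Finset.card_biUnion fun i _ j _ hij => hd i j hij]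
  calc ∑ i, (P i).card + k = ∑ i : Fin k, ((P i).card + 1) := by simp [Finset.sum_add_distrib]
    _ = k * W.card := by simp [fun i => (hP i).1.card_add_one]

theorem IsKArborescence.card_induced_add_le (h : D.IsKArborescence k W F) {U : Finset V}
    (hU : U ⊆ W) (hne : U.Nonempty) : (D.induced F U).card + k ≤ k * U.card := by
  obtain ⟨P, hP, hd, rfl⟩ := h
  have h1 : D.induced (Finset.univ.biUnion P) U = Finset.univ.biUnion fun i => D.induced (P i) U := by
    simp [induced, Finset.filter_biUnion]
  rw [h1]
  calc (Finset.univ.biUnion fun i => D.induced (P i) U).card + k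
      ≤ ∑ i, (D.induced (P i) U).card + k := Nat.add_le_add_right Finset.card_biUnion_le k
    _ = ∑ i : Fin k, ((D.induced (P i) U).card + 1) := by simp [Finset.sum_add_distrib]
    _ ≤ ∑ _i : Fin k, U.card :=
        Finset.sum_le_sum fun i _ => (hP i).1.card_induced_add_one_le hU hne
    _ = k * U.card := by simp

theorem IsKArborescence.card_head_le (h : D.IsKArborescence k W F) {v : V} (hv : v ∈ W) :
    (F.filter fun e => D.head e = v).card ≤ k := by
  obtain ⟨P, hP, hd, rfl⟩ := h
  rw [Finset.filter_biUnion]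
  calc _ ≤ ∑ i, ((P i).filter fun e => D.head e = v).card := Finset.card_biUnion_le
    _ ≤ ∑ _i : Fin k, 1 := Finset.sum_le_sum fun i _ => (hP i).2 v hv
    _ = k := by simp

end KArborescence

/-- The arc `e` of `D[W]` contributes to `f_W(Z)`. -/
def Counted (D : MultiDigraph V A) (L : Finset (Finset V)) (W Z : Finset V) (e : A) : Prop :=
  (D.tail e ∈ W ∧ D.head e ∈ W) ∧ D.Enters e Z ∧
    ∀ W' ∈ L, W' ⊆ W → (W' ∩ Z).Nonempty → ¬ D.Leaves e W'

instance (L : Finset (Finset V)) (W Z : Finset V) : DecidablePred (D.Counted L W Z) :=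
  fun _ => inferInstanceAs (Decidable (_ ∧ _))

theorem f_eq_card_counted [Fintype A] (L : Finset (Finset V)) (W Z : Finset V) :
    D.f L W Z = (Finset.univ.filter (D.Counted L W Z)).card := by
  simp only [f, induced, Finset.filter_filter]
  congr

/-- `C` is the set of maximal proper subsets of `W` in `L`, and these partition `W`. -/
structure IsChildren (L : Finset (Finset V)) (W : Finset V) (C : Finset (Finset V)) : Prop where
  mem : ∀ j ∈ C, j ∈ L
  ssubset : ∀ j ∈ C, j ⊂ W
  eq_of_mem : ∀ i ∈ C, ∀ j ∈ C, ∀ v ∈ i, v ∈ j → i = j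
  cover : ∀ v ∈ W, ∃ j ∈ C, v ∈ j
  maximal : ∀ W' ∈ L, W' ⊂ W → ∃ j ∈ C, W' ⊆ j

/-- Maximality together with laminarity gives disjointness. Singletons give covering, being proper
subsets because `W` has at least two nodes. -/
theorem exists_isChildren {L : Finset (Finset V)} (hL : IsLaminar L) (hs : ∀ v, {v} ∈ L)
    {W : Finset V} (hW : 2 ≤ W.card) : ∃ C, IsChildren L W C := by
  classical
  let P : Finset (Finset V) := L.filter fun j => j ⊂ W
  have hmax : ∀ W' ∈ P, ∃ j, Maximal (· ∈ P) j ∧ W' ⊆ j := fun W' hW' => by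
    obtain ⟨j, hj, hj'⟩ := P.exists_le_maximal hW'
    exact ⟨j, hj', hj⟩
  refine ⟨P.filter fun j => Maximal (· ∈ P) j, ?_, ?_, ?_, ?_, ?_⟩
  · intro j hj
    exact (Finset.mem_filter.mp (Finset.mem_filter.mp hj).1).1
  · intro j hj
    exact (Finset.mem_filter.mp (Finset.mem_filter.mp hj).1).2
  · intro i hi j hj v hvi hvj
    rw [Finset.mem_filter] at hi hj
    rcases hL i (Finset.mem_filter.mp hi.1).1 j (Finset.mem_filter.mp hj.1).1 with h | h | h
    · exact absurd hvj (Finset.disjoint_left.mp h hvi)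
    · exact h.antisymm (hi.2.2 hj.1 h)
    · exact (hj.2.2 hi.1 h).antisymm h
  · intro v hv
    have hvP : {v} ∈ P := by
      refine Finset.mem_filter.mpr ⟨hs v, Finset.ssubset_iff_subset_ne.mpr ⟨by simpa using hv, ?_⟩⟩
      rintro rfl
      simp at hW
    obtain ⟨j, hj, hvj⟩ := hmax _ hvP
    exact ⟨j, Finset.mem_filter.mpr ⟨hj.1, hj⟩, by simpa using hvj⟩
  · intro W' hW' hlt
    obtain ⟨j, hj, hvj⟩ := hmax W' (Finset.mem_filter.mpr ⟨hW', hlt⟩)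
    exact ⟨j, Finset.mem_filter.mpr ⟨hj.1, hj⟩, hvj⟩

/-! ### Counted arcs and their recursion along the laminar family. -/

section Children

variable {L : Finset (Finset V)} {W : Finset V} {C : Finset (Finset V)}

theorem IsChildren.pairwiseDisjoint (hC : IsChildren L W C) :
    (C : Set (Finset V)).PairwiseDisjoint id := fun i hi j hj hij =>
  Finset.disjoint_left.mpr fun v hvi hvj => hij (hC.eq_of_mem i hi j hj v hvi hvj)

/-- A member of `L` inside `W` that is left by an arc of `D[j]` cannot contain `j` or be disjoint
from it, so it lies inside `j`. -/
theorem IsChildren.counted_iff_of_mem (hL : IsLaminar L) (hC : IsChildren L W C) {j : Finset V}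
    (hj : j ∈ C) {Z : Finset V} {e : A} (ht : D.tail e ∈ j) (hh : D.head e ∈ j) :
    D.Counted L W Z e ↔ D.Counted L j (Z ∩ j) e := by
  have hjW := (hC.ssubset j hj).subset
  simp only [Counted, Enters, Finset.mem_inter, ht, hh, hjW ht, hjW hh, and_true, true_and]
  refine and_congr Iff.rfl ⟨fun h W' hW' hW'j hne => ?_, fun h W' hW' hW'W hne hlv => ?_⟩
  · refine h W' hW' (hW'j.trans hjW) (hne.mono ?_)
    exact Finset.inter_subset_inter (Finset.Subset.refl _) Finset.inter_subset_left
  · have hW'j : W' ⊆ j := by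
      rcases hL W' hW' j (hC.mem j hj) with h' | h' | h'
      · exact absurd ht (Finset.disjoint_left.mp h' hlv.1)
      · exact h'
      · exact absurd (h' hh) hlv.2
    refine h W' hW' hW'j ?_ hlv
    obtain ⟨x, hx⟩ := hne
    rw [Finset.mem_inter] at hx
    exact ⟨x, by simp [hx, hW'j hx.1]⟩

/-- Every member of `L` inside `W` that the arc leaves lies in the child `i` of its tail, and `i`
itself is left, so only `i` matters. -/
theorem IsChildren.counted_iff_of_ne (hC : IsChildren L W C) {i j : Finset V} (hi : i ∈ C)
    (hj : j ∈ C) (hij : i ≠ j) {Z : Finset V} {e : A} (ht : D.tail e ∈ i) (hh : D.head e ∈ j) :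
    D.Counted L W Z e ↔ D.head e ∈ Z ∧ Disjoint i Z := by
  have hiW := (hC.ssubset i hi).subset
  have hjW := (hC.ssubset j hj).subset
  have hhi : D.head e ∉ i := fun h => hij (hC.eq_of_mem i hi j hj _ h hh)
  constructor
  · rintro ⟨-, hent, h⟩
    refine ⟨hent.2, ?_⟩
    by_contra hd
    rw [Finset.disjoint_iff_inter_eq_empty, ← Ne, ← Finset.nonempty_iff_ne_empty] at hd
    exact h i (hC.mem i hi) hiW hd ⟨ht, hhi⟩
  · rintro ⟨hhZ, hd⟩
    refine ⟨⟨hiW ht, hjW hh⟩, ⟨Finset.disjoint_left.mp hd ht, hhZ⟩, ?_⟩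
    intro W' hW' hW'W hne hlv
    have hlt : W' ⊂ W := Finset.ssubset_iff_subset_ne.mpr
      ⟨hW'W, fun h => hlv.2 (h ▸ hjW hh)⟩
    obtain ⟨i', hi', hW'i'⟩ := hC.maximal W' hW' hlt
    have : i = i' := hC.eq_of_mem i hi i' hi' _ ht (hW'i' hlv.1)
    subst this
    obtain ⟨x, hx⟩ := hne
    rw [Finset.mem_inter] at hx
    exact Finset.disjoint_left.mp hd (hW'i' hx.1) hx.2

theorem IsChildren.sum_card_inter (hC : IsChildren L W C) {X : Finset (Finset V)} (hX : X ⊆ C)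
    {Z : Finset V} (hZ : Z ⊆ X.biUnion id) : ∑ j ∈ X, (Z ∩ j).card = Z.card := by
  rw [← Finset.card_biUnion]
  · congr 1
    ext v
    simp only [Finset.mem_biUnion, Finset.mem_inter]
    refine ⟨fun ⟨_, _, h, _⟩ => h, fun h => ?_⟩
    obtain ⟨j, hj, hv⟩ := Finset.mem_biUnion.mp (hZ h)
    exact ⟨j, hj, h, hv⟩
  · intro i hi j hj hij
    exact (hC.pairwiseDisjoint (hX hi) (hX hj) hij).mono Finset.inter_subset_right
      Finset.inter_subset_right

/-- In a sparse arc set that is tight on a laminar family, few arcs with head in `Z` are not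
counted by `f_W(Z)`. -/
theorem card_not_counted_add_le [DecidableEq A] (hL : IsLaminar L) (hs : ∀ v, {v} ∈ L) {k : ℕ}
    {F : Finset A} (hF : ∀ U : Finset V, U.Nonempty → (D.induced F U).card + k ≤ k * U.card)
    (hFL : ∀ W ∈ L, (D.induced F W).card + k = k * W.card) {W : Finset V} (hW : W ∈ L)
    {Z : Finset V} (hZW : Z ⊆ W) (hZ : Z.Nonempty) :
    ((D.induced F W).filter fun e => D.head e ∈ Z ∧ ¬ D.Counted L W Z e).card + k
      ≤ k * Z.card := by
  induction hn : W.card using Nat.strong_induction_on generalizing W Z with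
  | _ n ih =>
    subst hn
    have hW0 : 0 < W.card := Finset.card_pos.mpr (hZ.mono hZW)
    rcases Nat.lt_or_ge W.card 2 with h1 | h2
    · have h3 := hFL W hW
      have h4 : W.card = 1 := by omega
      rw [h4] at h3
      have h5 : ((D.induced F W).filter fun e => D.head e ∈ Z ∧ ¬ D.Counted L W Z e).card ≤ _ :=
        Finset.card_filter_le _ _
      have h6 : k * 1 ≤ k * Z.card := Nat.mul_le_mul_left k (Finset.card_pos.mpr hZ)
      omega
    obtain ⟨C, hC⟩ := exists_isChildren hL hs h2
    let X := C.filter fun j => (Z ∩ j).Nonempty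
    have hXC : X ⊆ C := Finset.filter_subset _ _
    let U := X.biUnion id
    have hZU : Z ⊆ U := fun z hz => by
      obtain ⟨j, hj, hzj⟩ := hC.cover z (hZW hz)
      exact Finset.mem_biUnion.mpr
        ⟨j, Finset.mem_filter.mpr ⟨hj, z, Finset.mem_inter.mpr ⟨hz, hzj⟩⟩, hzj⟩
    let N : Finset V → Finset A := fun j =>
      (D.induced F j).filter fun e => D.head e ∈ Z ∩ j ∧ ¬ D.Counted L j (Z ∩ j) e
    let I : Finset A := X.biUnion fun j => D.induced F j
    have hIU : I ⊆ D.induced F U := by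
      refine Finset.biUnion_subset.mpr fun j hj e he => ?_
      simp only [induced, Finset.mem_filter] at he ⊢
      exact ⟨he.1, Finset.mem_biUnion.mpr ⟨j, hj, he.2.1⟩, Finset.mem_biUnion.mpr ⟨j, hj, he.2.2⟩⟩
    have hsub : ((D.induced F W).filter fun e => D.head e ∈ Z ∧ ¬ D.Counted L W Z e) ⊆
        (X.biUnion N) ∪ (D.induced F U \ I) := by
      intro e he
      simp only [induced, Finset.mem_filter] at he
      obtain ⟨⟨heF, htW, hhW⟩, hhZ, hnc⟩ := he
      obtain ⟨i, hi, hti⟩ := hC.cover _ htW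
      obtain ⟨j, hj, hhj⟩ := hC.cover _ hhW
      have hjX : j ∈ X := Finset.mem_filter.mpr ⟨hj, _, Finset.mem_inter.mpr ⟨hhZ, hhj⟩⟩
      by_cases hij : i = j
      · subst hij
        refine Finset.mem_union_left _ (Finset.mem_biUnion.mpr ⟨i, hjX, ?_⟩)
        simp only [N, induced, Finset.mem_filter, Finset.mem_inter]
        exact ⟨⟨heF, hti, hhj⟩, ⟨hhZ, hhj⟩, fun h =>
          hnc ((hC.counted_iff_of_mem hL hi hti hhj).mpr h)⟩
      · rw [hC.counted_iff_of_ne hi hj hij hti hhj] at hnc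
        have hiX : i ∈ X := by
          refine Finset.mem_filter.mpr ⟨hi, ?_⟩
          rw [Finset.nonempty_iff_ne_empty, Ne, ← Finset.disjoint_iff_inter_eq_empty, disjoint_comm]
          exact fun h => hnc ⟨hhZ, h⟩
        refine Finset.mem_union_right _ (Finset.mem_sdiff.mpr ⟨?_, ?_⟩)
        · simp only [induced, Finset.mem_filter]
          exact ⟨heF, Finset.mem_biUnion.mpr ⟨i, hiX, hti⟩, Finset.mem_biUnion.mpr ⟨j, hjX, hhj⟩⟩
        · simp only [I, induced, Finset.mem_biUnion, Finset.mem_filter, not_exists, not_and]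
          intro l hl _ htl hhl
          exact hij ((hC.eq_of_mem i hi l (hXC hl) _ hti htl).trans
            (hC.eq_of_mem l (hXC hl) j hj _ hhl hhj))
    have h1 : ∑ j ∈ X, ((N j).card + k) ≤ ∑ j ∈ X, k * (Z ∩ j).card := by
      refine Finset.sum_le_sum fun j hj => ?_
      exact ih j.card (Finset.card_lt_card (hC.ssubset j (hXC hj))) (hC.mem j (hXC hj))
        Finset.inter_subset_right (Finset.mem_filter.mp hj).2 rfl
    rw [← Finset.mul_sum, hC.sum_card_inter hXC hZU, Finset.sum_add_distrib] at h1
    have h3 : I.card = ∑ j ∈ X, (D.induced F j).card := by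
      refine Finset.card_biUnion fun i hi j hj hij => Finset.disjoint_left.mpr fun e hei hej => ?_
      simp only [induced, Finset.mem_filter] at hei hej
      exact hij (hC.eq_of_mem i (hXC hi) j (hXC hj) _ hei.2.1 hej.2.1)
    have h4 : ∑ j ∈ X, ((D.induced F j).card + k) = ∑ j ∈ X, k * j.card :=
      Finset.sum_congr rfl fun j hj => hFL j (hC.mem j (hXC hj))
    have h5 : U.card = ∑ j ∈ X, j.card :=
      Finset.card_biUnion fun i hi j hj hij => hC.pairwiseDisjoint (hXC hi) (hXC hj) hij
    rw [Finset.sum_add_distrib, ← Finset.mul_sum, ← h5, ← h3] at h4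
    -- Uncounted arcs inside children number at most `k|Z| - k|X|` by induction. Those between
    -- children lie in `F[U]` minus the arcs inside children, which leaves at most `(k|U| - k) -
    -- (k|U| - k|X|) = k|X| - k`.
    have h6 := hF U (hZ.mono hZU)
    have h7 := Finset.card_sdiff_add_card_eq_card hIU
    have h8 : (X.biUnion N).card ≤ ∑ j ∈ X, (N j).card := Finset.card_biUnion_le
    have h9 := (Finset.card_le_card hsub).trans (Finset.card_union_le _ _)
    omega

end Children

/-! ### Transversals obtained from two disjoint sets. -/

section Tight

variable [Fintype V] [DecidableEq A] {L : Finset (Finset V)} {k : ℕ}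

/-- The laminar family `L` together with all singletons. -/
def withSingletons (L : Finset (Finset V)) : Finset (Finset V) :=
  L ∪ Finset.univ.image fun v => {v}

theorem singleton_mem_withSingletons (v : V) : {v} ∈ withSingletons L := by
  simp [withSingletons]

theorem subset_withSingletons : L ⊆ withSingletons L := Finset.subset_union_left

theorem mem_withSingletons {W : Finset V} :
    W ∈ withSingletons L ↔ W ∈ L ∨ ∃ v, W = {v} := by
  simp [withSingletons, eq_comm]

theorem isLaminar_withSingletons (hL : IsLaminar L) : IsLaminar (withSingletons L) := by
  have key : ∀ (v : V) (Y : Finset V), Disjoint {v} Y ∨ {v} ⊆ Y := fun v Y => by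
    by_cases h : v ∈ Y <;> simp [h]
  intro X hX Y hY
  rcases mem_withSingletons.mp hX with hX | ⟨v, rfl⟩
  · rcases mem_withSingletons.mp hY with hY | ⟨w, rfl⟩
    · exact hL X hX Y hY
    · rcases key w X with h | h
      · exact Or.inl h.symm
      · exact Or.inr (Or.inr h)
  · rcases key v Y with h | h
    · exact Or.inl h
    · exact Or.inr (Or.inl h)

/-- An arc entering `Z` has its tail outside `Z`, so it never leaves a singleton that meets `Z`. -/
theorem counted_withSingletons {W Z : Finset V} {e : A} :
    D.Counted (withSingletons L) W Z e ↔ D.Counted L W Z e := by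
  refine and_congr Iff.rfl (and_congr_right fun hent =>
    ⟨fun h W' hW' => h W' (subset_withSingletons hW'), fun h W' hW' hW'W hne hlv => ?_⟩)
  rcases mem_withSingletons.mp hW' with hW' | ⟨v, rfl⟩
  · exact h W' hW' hW'W hne hlv
  · obtain ⟨x, hx⟩ := hne
    rw [Finset.mem_inter, Finset.mem_singleton] at hx
    have := Finset.mem_singleton.mp hlv.1
    exact hent.1 (this ▸ hx.1 ▸ hx.2)

theorem f_withSingletons [Fintype A] (W Z : Finset V) :
    D.f (withSingletons L) W Z = D.f L W Z := by
  rw [f_eq_card_counted, f_eq_card_counted]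
  simp only [counted_withSingletons]

/-- Every tight `k`-arborescence contains at least `k` of the arcs counted by two disjoint sets. -/
theorem IsTight.le_card_counted (hL : IsLaminar L) {F : Finset A} (hF : D.IsTight L k F)
    {W : Finset V} (hW : W ∈ L) {Z₁ Z₂ : Finset V} (h₁ : Z₁.Nonempty) (h₂ : Z₂.Nonempty)
    (h₁W : Z₁ ⊆ W) (h₂W : Z₂ ⊆ W) (hd : Disjoint Z₁ Z₂) :
    k ≤ (F.filter (D.Counted L W Z₁)).card + (F.filter (D.Counted L W Z₂)).card := by
  have hsp : ∀ U : Finset V, U.Nonempty → (D.induced F U).card + k ≤ k * U.card :=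
    fun U hU => hF.1.card_induced_add_le (Finset.subset_univ U) hU
  have htight : ∀ W ∈ withSingletons L, (D.induced F W).card + k = k * W.card := by
    intro W hW
    rcases mem_withSingletons.mp hW with hW | ⟨v, rfl⟩
    · exact (hF.2 W hW).card_add
    · have := hsp {v} (by simp)
      rw [Finset.card_singleton] at this ⊢
      omega
  have key : ∀ Z ⊆ W, Z.Nonempty → ((D.induced F W).filter fun e => D.head e ∈ Z).card + k ≤
      k * Z.card + (F.filter (D.Counted L W Z)).card := by
    intro Z hZW hZ
    have h1 := card_not_counted_add_le (isLaminar_withSingletons hL) singleton_mem_withSingletons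
      hsp htight (subset_withSingletons hW) hZW hZ
    simp only [counted_withSingletons] at h1
    have h2 : ((D.induced F W).filter fun e => D.head e ∈ Z) ⊆
        ((D.induced F W).filter fun e => D.head e ∈ Z ∧ ¬ D.Counted L W Z e) ∪
          F.filter (D.Counted L W Z) := by
      intro e he
      rw [Finset.mem_filter] at he
      have heF : e ∈ F := (Finset.mem_filter.mp he.1).1
      by_cases hc : D.Counted L W Z e
      · simp [heF, hc]
      · simp [he, hc]
    have h3 := (Finset.card_le_card h2).trans (Finset.card_union_le _ _)
    omega
  have hk1 := key Z₁ h₁W h₁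
  have hk2 := key Z₂ h₂W h₂
  -- The `k|W| - k` arcs of `F[W]` are sorted by head into `Z₁`, `Z₂` and `R`; at most `k` arcs
  -- share a head in `R`.
  let R := W \ (Z₁ ∪ Z₂)
  have hR : ((D.induced F W).filter fun e => D.head e ∈ R).card ≤ k * R.card := by
    refine Finset.card_le_mul_card_image_of_maps_to (f := D.head)
      (s := (D.induced F W).filter fun e => D.head e ∈ R) (fun e he => (Finset.mem_filter.mp he).2) k fun v hv => ?_
    refine le_trans (Finset.card_le_card ?_)
      ((hF.2 W hW).card_head_le (Finset.mem_sdiff.mp hv).1)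
    exact Finset.filter_subset_filter _ (Finset.filter_subset _ _)
  have hcov : D.induced F W ⊆ ((D.induced F W).filter fun e => D.head e ∈ Z₁) ∪
      (((D.induced F W).filter fun e => D.head e ∈ Z₂) ∪
        ((D.induced F W).filter fun e => D.head e ∈ R)) := by
    intro e he
    have hh : D.head e ∈ W := (Finset.mem_filter.mp he).2.2
    simp only [Finset.mem_union, Finset.mem_filter, R, Finset.mem_sdiff, he, hh, true_and]
    tauto
  have hc1 := Finset.card_le_card hcov
  have hc2 := Finset.card_union_le ((D.induced F W).filter fun e => D.head e ∈ Z₁)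
    (((D.induced F W).filter fun e => D.head e ∈ Z₂) ∪
        ((D.induced F W).filter fun e => D.head e ∈ R))
  have hc3 := Finset.card_union_le ((D.induced F W).filter fun e => D.head e ∈ Z₂)
        ((D.induced F W).filter fun e => D.head e ∈ R)
  have hWc := (hF.2 W hW).card_add
  have hcard : W.card = Z₁.card + Z₂.card + R.card := by
    have := Finset.card_sdiff_add_card_eq_card (Finset.union_subset h₁W h₂W)
    rw [Finset.card_union_of_disjoint hd] at this
    simp only [R]
    omega
  rw [hcard, mul_add, mul_add] at hWc
  omega

/-- Two disjoint subsets of a member of `L` give a transversal. -/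
theorem exists_isTransversal [Fintype A] (hL : IsLaminar L) (hk : 0 < k)
    (hex : ∃ F : Finset A, D.IsTight L k F) {W : Finset V} (hW : W ∈ L) {Z₁ Z₂ : Finset V}
    (h₁ : Z₁.Nonempty) (h₂ : Z₂.Nonempty) (h₁W : Z₁ ⊆ W) (h₂W : Z₂ ⊆ W) (hd : Disjoint Z₁ Z₂) :
    ∃ H : Finset A, D.IsTransversal L k H ∧ H.card + k = D.f L W Z₁ + D.f L W Z₂ + 1 := by
  let K₁ := Finset.univ.filter (D.Counted L W Z₁)
  let K₂ := Finset.univ.filter (D.Counted L W Z₂)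
  have hdK : Disjoint K₁ K₂ := Finset.disjoint_left.mpr fun e he he' =>
    Finset.disjoint_left.mp hd (Finset.mem_filter.mp he).2.2.1.2 (Finset.mem_filter.mp he').2.2.1.2
  have hcK : (K₁ ∪ K₂).card = D.f L W Z₁ + D.f L W Z₂ := by
    rw [Finset.card_union_of_disjoint hdK, f_eq_card_counted, f_eq_card_counted]
  have hmeet : ∀ F, D.IsTight L k F → k ≤ (F ∩ (K₁ ∪ K₂)).card := by
    intro F hF
    have h := hF.le_card_counted hL hW h₁ h₂ h₁W h₂W hd
    have e₁ : F.filter (D.Counted L W Z₁) = F ∩ K₁ := by ext; simp [K₁]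
    have e₂ : F.filter (D.Counted L W Z₂) = F ∩ K₂ := by ext; simp [K₂]
    rw [e₁, e₂, ← Finset.card_union_of_disjoint
      (hdK.mono Finset.inter_subset_right Finset.inter_subset_right),
      ← Finset.inter_union_distrib_left] at h
    exact h
  obtain ⟨F₀, hF₀⟩ := hex
  have hle : k ≤ (K₁ ∪ K₂).card :=
    (hmeet F₀ hF₀).trans (Finset.card_le_card Finset.inter_subset_right)
  -- `H` omits exactly `k - 1` of the counted arcs, too few to hold the `k` that every tight
  -- `k`-arborescence uses.
  obtain ⟨H, hHK, hH⟩ := Finset.exists_subset_card_eq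
    (show (K₁ ∪ K₂).card + 1 - k ≤ (K₁ ∪ K₂).card by omega)
  refine ⟨H, fun F hF => ?_, by omega⟩
  by_contra hemp
  rw [Finset.not_nonempty_iff_eq_empty] at hemp
  have hsub : F ∩ (K₁ ∪ K₂) ⊆ (K₁ ∪ K₂) \ H := by
    intro e he
    rw [Finset.mem_inter] at he
    refine Finset.mem_sdiff.mpr ⟨he.2, fun heH => ?_⟩
    have : e ∈ F ∩ H := Finset.mem_inter.mpr ⟨he.1, heH⟩
    simp [hemp] at this
  have h1 := (hmeet F hF).trans (Finset.card_le_card hsub)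
  have h2 := Finset.card_sdiff_add_card_eq_card hHK
  omega

end Tight

end MultiDigraph

/-! ### Supermodular lower bounds for integral root vectors. -/

namespace MultiDigraph

section Supermodular

variable {V : Type*} [DecidableEq V]

/-- The total weight of `Z` under `m`, as an integer. -/
def tot (m : V → ℕ) (Z : Finset V) : ℤ := ∑ v ∈ Z, (m v : ℤ)

theorem tot_nonneg (m : V → ℕ) (Z : Finset V) : 0 ≤ tot m Z :=
  Finset.sum_nonneg fun _ _ => Int.natCast_nonneg _

theorem tot_mono (m : V → ℕ) {Y Z : Finset V} (h : Y ⊆ Z) : tot m Y ≤ tot m Z :=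
  Finset.sum_le_sum_of_subset_of_nonneg h fun _ _ _ => Int.natCast_nonneg _

theorem tot_inter_add_tot_union (m : V → ℕ) (Y Z : Finset V) :
    tot m (Y ∩ Z) + tot m (Y ∪ Z) = tot m Y + tot m Z := by
  rw [add_comm]
  exact Finset.sum_union_inter

theorem tot_eq_natCast (m : V → ℕ) (Z : Finset V) : tot m Z = ((∑ v ∈ Z, m v : ℕ) : ℤ) := by
  simp [tot]

/-- A lower bound function on root vectors of total weight `k` on `W`. -/
structure IsRootBound (k : ℕ) (W : Finset V) (p : Finset V → ℤ) : Prop where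
  empty : p ∅ = 0
  self : p W = k
  le : ∀ Z ⊆ W, p Z ≤ k
  supermodular : ∀ X ⊆ W, ∀ Y ⊆ W, p X + p Y ≤ p (X ∩ Y) + p (X ∪ Y)

/-- `q` is supermodular on intersecting subsets of `W` of positive value. -/
def IsIntersectingSupermodular (W : Finset V) (q : Finset V → ℤ) : Prop :=
  ∀ X ⊆ W, ∀ Y ⊆ W, (X ∩ Y).Nonempty → 0 < q X → 0 < q Y → q X + q Y ≤ q (X ∩ Y) + q (X ∪ Y)

/-- `T` is a set of positive `q`-value at which `m ≥ q` holds with equality. -/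
structure IsTightSet (W : Finset V) (q : Finset V → ℤ) (m : V → ℕ) (T : Finset V) : Prop where
  subset : T ⊆ W
  pos : 0 < q T
  eq : tot m T = q T

variable {W : Finset V} {q : Finset V → ℤ} {m : V → ℕ}

/-- Uncrossing against the modular `m`. The intersection may have value zero, so it gets only the
equality; a common node of positive weight makes it a tight set. -/
theorem IsTightSet.inter_union (hq : IsIntersectingSupermodular W q)
    (hm : ∀ Z ⊆ W, q Z ≤ tot m Z) {X Y : Finset V} (hX : IsTightSet W q m X)
    (hY : IsTightSet W q m Y) (hne : (X ∩ Y).Nonempty) :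
    tot m (X ∩ Y) = q (X ∩ Y) ∧ IsTightSet W q m (X ∪ Y) := by
  have h1 := hq X hX.subset Y hY.subset hne hX.pos hY.pos
  have h2 := tot_inter_add_tot_union m X Y
  have hU := Finset.union_subset hX.subset hY.subset
  have h3 := hm (X ∩ Y) (Finset.inter_subset_left.trans hX.subset)
  have h4 := hm (X ∪ Y) hU
  have h5 := hX.eq
  have h6 := hY.eq
  have h7 := tot_mono m (Finset.subset_union_left (s₁ := X) (s₂ := Y))
  have h8 := hX.pos
  exact ⟨by omega, hU, by omega, by omega⟩

theorem IsTightSet.inter (hq : IsIntersectingSupermodular W q)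
    (hm : ∀ Z ⊆ W, q Z ≤ tot m Z) {X Y : Finset V} (hX : IsTightSet W q m X)
    (hY : IsTightSet W q m Y) {u : V} (huX : u ∈ X) (huY : u ∈ Y) (hu : 0 < m u) :
    IsTightSet W q m (X ∩ Y) := by
  have hmem : u ∈ X ∩ Y := Finset.mem_inter.mpr ⟨huX, huY⟩
  have h1 := (hX.inter_union hq hm hY ⟨u, hmem⟩).1
  have h2 : (m u : ℤ) ≤ tot m (X ∩ Y) := by
    have := tot_mono m (Finset.singleton_subset_iff.mpr hmem)
    simpa [tot] using this
  exact ⟨Finset.inter_subset_left.trans hX.subset, by omega, h1⟩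

/-- If the support of `m` in `Z` is covered by tight subsets of `Z`, then `m(Z)` is a sum of
`q`-values of disjoint subsets of `Z`. -/
theorem exists_disjoint_family_of_tight (hq : IsIntersectingSupermodular W q)
    (hm : ∀ Z ⊆ W, q Z ≤ tot m Z) {Z : Finset V}
    (hZ : ∀ u ∈ Z, 0 < m u → ∃ T, IsTightSet W q m T ∧ u ∈ T ∧ T ⊆ Z) :
    ∃ M : Finset (Finset V), (∀ T ∈ M, T ⊆ Z ∧ 0 < q T ∧ T ⊆ W) ∧
      (M : Set (Finset V)).PairwiseDisjoint id ∧ tot m Z = ∑ T ∈ M, q T := by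
  classical
  let P : Finset (Finset V) := Z.powerset.filter fun T => IsTightSet W q m T
  have hP : ∀ {T}, T ∈ P ↔ T ⊆ Z ∧ IsTightSet W q m T := by simp [P]
  have hd : ((P.filter fun T => Maximal (· ∈ P) T : Finset (Finset V)) :
      Set (Finset V)).PairwiseDisjoint id := by
    intro S hS T hT hST
    rw [Finset.mem_coe, Finset.mem_filter] at hS hT
    by_contra hnd
    have hne : (S ∩ T).Nonempty := by
      rw [Finset.nonempty_iff_ne_empty, Ne, ← Finset.disjoint_iff_inter_eq_empty]
      exact hnd
    have hU : S ∪ T ∈ P := hP.mpr ⟨Finset.union_subset (hP.mp hS.1).1 (hP.mp hT.1).1,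
      ((hP.mp hS.1).2.inter_union hq hm (hP.mp hT.1).2 hne).2⟩
    have h1 : S = S ∪ T := Finset.subset_union_left.antisymm (hS.2.2 hU Finset.subset_union_left)
    have h2 : T = S ∪ T := Finset.subset_union_right.antisymm (hT.2.2 hU Finset.subset_union_right)
    exact hST (h1.trans h2.symm)
  refine ⟨P.filter fun T => Maximal (· ∈ P) T, ?_, hd, ?_⟩
  · intro T hT
    have := hP.mp (Finset.mem_filter.mp hT).1
    exact ⟨this.1, this.2.pos, this.2.subset⟩
  · have h1 : ∑ T ∈ P.filter (fun T => Maximal (· ∈ P) T), q T =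
        ∑ T ∈ P.filter (fun T => Maximal (· ∈ P) T), ∑ v ∈ T, (m v : ℤ) :=
      Finset.sum_congr rfl fun T hT => (hP.mp (Finset.mem_filter.mp hT).1).2.eq.symm
    rw [h1, ← Finset.sum_biUnion (t := fun T : Finset V => T) hd]
    symm
    refine Finset.sum_subset ?_ ?_
    · exact Finset.biUnion_subset.mpr fun T hT => (hP.mp (Finset.mem_filter.mp hT).1).1
    · intro u hu hnot
      by_contra hpos
      obtain ⟨T, hT, huT, hTZ⟩ := hZ u hu (by omega)
      obtain ⟨T', hTT', hT'⟩ := P.exists_le_maximal (hP.mpr ⟨hTZ, hT⟩)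
      exact hnot (Finset.mem_biUnion.mpr ⟨T', Finset.mem_filter.mpr ⟨hT'.1, hT'⟩, hTT' huT⟩)

/-- Either `u` lies in a tight subset of `Y`, or a unit of weight can be moved from `u` to some
node outside `Y`. -/
theorem exists_tight_or_exchange (hq : IsIntersectingSupermodular W q)
    (hm : ∀ Z ⊆ W, q Z ≤ tot m Z) {Y : Finset V} (hY : Y ⊂ W) {u : V} (hu : 0 < m u) :
    (∃ T, IsTightSet W q m T ∧ u ∈ T ∧ T ⊆ Y) ∨ ∃ v ∈ W \ Y, ∃ m' : V → ℕ,
      (∀ Z ⊆ W, q Z ≤ tot m' Z) ∧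
      ∀ Z, tot m' Z = tot m Z - (if u ∈ Z then 1 else 0) + if v ∈ Z then 1 else 0 := by
  by_cases hex : ∃ v ∈ W \ Y, ∀ T, IsTightSet W q m T → u ∈ T → v ∈ T
  · right
    obtain ⟨v, hv, hT⟩ := hex
    let m' : V → ℕ := fun x => (m x - if x = u then 1 else 0) + if x = v then 1 else 0
    have hm' : ∀ Z, tot m' Z = tot m Z - (if u ∈ Z then 1 else 0) + if v ∈ Z then 1 else 0 := by
      intro Z
      have h1 : ∀ x, (m' x : ℤ) = (m x - if x = u then 1 else 0) + if x = v then 1 else 0 := by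
        intro x
        simp only [m']
        split_ifs with h h' <;> subst_vars <;> push_cast [Nat.cast_sub hu] <;> simp
      simp only [tot, h1, Finset.sum_add_distrib, Finset.sum_sub_distrib, Finset.sum_ite_eq']
    refine ⟨v, hv, m', fun Z hZ => ?_, hm'⟩
    rw [hm']
    have h1 := hm Z hZ
    have h2 : u ∈ Z → v ∉ Z → q Z < tot m Z := by
      intro huZ hvZ
      refine lt_of_le_of_ne h1 fun heq => hvZ (hT Z ⟨hZ, ?_, heq.symm⟩ huZ)
      have := tot_mono m (Finset.singleton_subset_iff.mpr huZ)
      simp only [tot, Finset.sum_singleton] at this heq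
      omega
    split_ifs with h h'
    · omega
    · have := h2 h h'; omega
    · omega
    · omega
  · left
    push Not at hex
    -- Each node outside `Y` is avoided by some tight set containing `u`. Intersecting these sets
    -- keeps tightness, because `u` has positive weight.
    have key : ∀ S : Finset V, S ⊆ W \ Y → S.Nonempty →
        ∃ T, IsTightSet W q m T ∧ u ∈ T ∧ ∀ v ∈ S, v ∉ T := by
      intro S
      induction S using Finset.induction_on with
      | empty => intro _ h; simp at h
      | insert v S _ ih =>
        intro hS _
        obtain ⟨T, hT, huT, hvT⟩ := hex v (hS (Finset.mem_insert_self _ _))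
        rcases S.eq_empty_or_nonempty with rfl | hne
        · exact ⟨T, hT, huT, by simpa using hvT⟩
        · obtain ⟨T', hT', huT', hST'⟩ := ih ((Finset.subset_insert _ _).trans hS) hne
          refine ⟨T ∩ T', hT.inter hq hm hT' huT huT' hu, Finset.mem_inter.mpr ⟨huT, huT'⟩, ?_⟩
          intro w hw hw'
          rw [Finset.mem_inter] at hw'
          rcases Finset.mem_insert.mp hw with rfl | hw
          · exact hvT hw'.1
          · exact hST' w hw hw'.2
    obtain ⟨T, hT, huT, hST⟩ := key (W \ Y) (Finset.Subset.refl _)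
      (Finset.sdiff_nonempty.mpr hY.2)
    refine ⟨T, hT, huT, fun v hv => ?_⟩
    by_contra hvY
    exact hST v (Finset.mem_sdiff.mpr ⟨hT.subset hv, hvY⟩) hv

/-- The greatest lower bound function of the vectors `m ≥ q` with `m(W) = k`. -/
theorem exists_isRootBound {k : ℕ} (hW : W.Nonempty) (h0 : q ∅ ≤ 0) (hk : ∀ Z ⊆ W, q Z ≤ k)
    (hq : IsIntersectingSupermodular W q)
    (hsum : ∀ M : Finset (Finset V), (∀ T ∈ M, T ⊆ W ∧ 0 < q T) →
      (M : Set (Finset V)).PairwiseDisjoint id → ∑ T ∈ M, q T ≤ k) :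
    ∃ p : Finset V → ℤ, IsRootBound k W p ∧
      (∀ m, (∀ Z ⊆ W, p Z ≤ tot m Z) → ∀ Z ⊆ W, q Z ≤ tot m Z) ∧
      (∃ m, tot m W = k ∧ ∀ Z ⊆ W, p Z ≤ tot m Z) ∧
      ∀ Z ⊂ W, ∃ M : Finset (Finset V), (∀ T ∈ M, T ⊆ Z ∧ 0 < q T ∧ T ⊆ W) ∧
        (M : Set (Finset V)).PairwiseDisjoint id ∧ p Z = ∑ T ∈ M, q T := by
  -- the set of feasible vectors is nonempty
  let S₀ : Set (V → ℕ) := {m | ∀ Z ⊆ W, q Z ≤ tot m Z}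
  let S : Set (V → ℕ) := {m | (∀ Z ⊆ W, q Z ≤ tot m Z) ∧ tot m W = k}
  have hS₀ : S₀.Nonempty := by
    refine ⟨fun _ => k, fun Z hZ => ?_⟩
    rcases Z.eq_empty_or_nonempty with rfl | ⟨z, hz⟩
    · simpa [tot] using h0
    · have := tot_mono (fun _ => k) (Finset.singleton_subset_iff.mpr hz)
      simp only [tot, Finset.sum_singleton] at this
      exact (hk Z hZ).trans this
  have hS : S.Nonempty := by
    -- For a dominating vector of least total weight on `W`, no positive entry can be lowered, so
    -- tight sets cover its support. Its weight is thus a sum of `q`-values of disjoint sets, at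
    -- most `k`.
    obtain ⟨m, hm, hmin⟩ := (measure fun m : V → ℕ => ∑ v ∈ W, m v).wf.has_min S₀ hS₀
    have hcov : ∀ u ∈ W, 0 < m u → ∃ T, IsTightSet W q m T ∧ u ∈ T ∧ T ⊆ W := by
      intro u hu hmu
      by_contra hno
      push Not at hno
      let m' : V → ℕ := fun x => m x - if x = u then 1 else 0
      have hm' : ∀ Z, tot m Z = tot m' Z + if u ∈ Z then 1 else 0 := by
        intro Z
        have h1 : ∀ x, (m x : ℤ) = m' x + if x = u then 1 else 0 := by
          intro x
          simp only [m']
          split_ifs with h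
          · subst h; push_cast [Nat.cast_sub hmu]; omega
          · simp
        simp only [tot, h1, Finset.sum_add_distrib, Finset.sum_ite_eq']
      refine hmin m' (fun Z hZ => ?_) ?_
      · have h1 := hm Z hZ
        have h2 := hm' Z
        split_ifs at h2 with huZ
        · by_contra hlt
          have h3 := tot_nonneg m' Z
          exact hno Z ⟨hZ, by omega, by omega⟩ huZ hZ
        · omega
      · have := hm' W
        rw [if_pos hu, tot_eq_natCast, tot_eq_natCast] at this
        change ∑ v ∈ W, m' v < ∑ v ∈ W, m v
        omega
    obtain ⟨M, hM, hMd, hMs⟩ := exists_disjoint_family_of_tight hq hm hcov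
    have hle : tot m W ≤ k := by
      rw [hMs]
      exact hsum M (fun T hT => ⟨(hM T hT).1, (hM T hT).2.1⟩) hMd
    obtain ⟨w, hw⟩ := hW
    -- The weight missing to reach `k` is all put on one node.
    let m' : V → ℕ := fun x => m x + if x = w then (k - tot m W).toNat else 0
    have hm' : ∀ Z, tot m' Z = tot m Z + if w ∈ Z then k - tot m W else 0 := by
      intro Z
      have h1 : ∀ x, (m' x : ℤ) = m x + if x = w then (k - tot m W) else 0 := by
        intro x
        simp only [m']
        split_ifs with h
        · push_cast; rw [Int.toNat_of_nonneg (by omega)]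
        · simp
      simp only [h1, tot, Finset.sum_add_distrib, Finset.sum_ite_eq']
    refine ⟨m', fun Z hZ => ?_, ?_⟩
    · rw [hm']
      have := hm Z hZ
      split_ifs <;> omega
    · rw [hm', if_pos hw]
      omega
  let p : Finset V → ℤ := fun Z => ((sInf ((fun m : V → ℕ => ∑ v ∈ Z, m v) '' S) : ℕ) : ℤ)
  have hp_le : ∀ Z, ∀ m ∈ S, p Z ≤ tot m Z := by
    intro Z m hm
    rw [tot_eq_natCast]
    exact Int.ofNat_le.mpr
      (Nat.sInf_le (Set.mem_image_of_mem (fun m : V → ℕ => ∑ v ∈ Z, m v) hm))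
  have hp_mem : ∀ Z, ∃ m ∈ S, tot m Z = p Z := by
    intro Z
    obtain ⟨m, hm, hm'⟩ := Nat.sInf_mem (hS.image fun m : V → ℕ => ∑ v ∈ Z, m v)
    exact ⟨m, hm, by rw [tot_eq_natCast]; exact congrArg Nat.cast hm'⟩
  -- two nested sets have a common minimiser, tight inside each of them
  have hsim : ∀ X Y, X ⊆ Y → Y ⊆ W → ∃ m ∈ S,
      (tot m X = p X ∧ tot m Y = p Y) ∧
      (Y ≠ W → ∀ u ∈ Y, 0 < m u → ∃ T, IsTightSet W q m T ∧ u ∈ T ∧ T ⊆ Y) := by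
    intro X Y hXY hYW
    obtain ⟨m, hm, hmin⟩ :=
      (measure fun m : V → ℕ => ∑ v ∈ X, m v + ∑ v ∈ Y, m v).wf.has_min S hS
    have hmin' : ∀ m' ∈ S, tot m X + tot m Y ≤ tot m' X + tot m' Y := by
      intro m' hm'
      have : ¬ (∑ v ∈ X, m' v + ∑ v ∈ Y, m' v < ∑ v ∈ X, m v + ∑ v ∈ Y, m v) := hmin m' hm'
      simp only [tot_eq_natCast]
      omega
    have htight : ∀ Z, Z = X ∨ Z = Y → Z ≠ W →
        ∀ u ∈ Z, 0 < m u → ∃ T, IsTightSet W q m T ∧ u ∈ T ∧ T ⊆ Z := by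
      intro Z hZ hZW u hu hmu
      have hZss : Z ⊂ W := Finset.ssubset_iff_subset_ne.mpr
        ⟨by rcases hZ with rfl | rfl; exacts [hXY.trans hYW, hYW], hZW⟩
      rcases exists_tight_or_exchange hq hm.1 hZss hmu with h | ⟨v, hv, m', hm', htot⟩
      · exact h
      exfalso
      rw [Finset.mem_sdiff] at hv
      have hm'S : m' ∈ S := by
        refine ⟨hm', ?_⟩
        rw [htot, if_pos (hZss.1 hu), if_pos hv.1, hm.2]
        omega
      have h1 := hmin' m' hm'S
      rw [htot X, htot Y] at h1
      -- Since `X ⊆ Y`, moving a unit out of either set lowers its own weight and does not raise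
      -- that of the other, against the minimality of the sum.
      rcases hZ with rfl | rfl
      · rw [if_pos hu, if_neg hv.2, if_pos (hXY hu)] at h1
        split_ifs at h1 <;> omega
      · have hvX : v ∉ X := fun h => hv.2 (hXY h)
        rw [if_pos hu, if_neg hv.2, if_neg hvX] at h1
        split_ifs at h1 <;> omega
    have heq : ∀ Z, Z = X ∨ Z = Y → tot m Z = p Z := by
      intro Z hZ
      refine le_antisymm ?_ (hp_le Z m hm)
      obtain ⟨m', hm', hpm'⟩ := hp_mem Z
      rw [← hpm']
      by_cases hZW : Z = W
      · rw [hZW, hm.2, hm'.2]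
      obtain ⟨M, hM, hMd, hMs⟩ := exists_disjoint_family_of_tight hq hm.1 (htight Z hZ hZW)
      rw [hMs]
      calc ∑ T ∈ M, q T ≤ ∑ T ∈ M, ∑ v ∈ T, (m' v : ℤ) :=
            Finset.sum_le_sum fun T hT => hm'.1 T (hM T hT).2.2
        _ = tot m' (M.biUnion fun T => T) :=
            (Finset.sum_biUnion (t := fun T : Finset V => T) hMd).symm
        _ ≤ tot m' Z := tot_mono m' (Finset.biUnion_subset.mpr fun T hT => (hM T hT).1)
    exact ⟨m, hm, ⟨heq X (Or.inl rfl), heq Y (Or.inr rfl)⟩, fun h => htight Y (Or.inr rfl) h⟩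
  refine ⟨p, ⟨?_, ?_, ?_, ?_⟩, ?_, ?_, ?_⟩
  · obtain ⟨m, -, hm⟩ := hp_mem ∅
    rw [← hm]
    simp [tot]
  · obtain ⟨m, hmS, hm⟩ := hp_mem W
    rw [← hm, hmS.2]
  · intro Z hZ
    obtain ⟨m, hmS⟩ := hS
    exact (hp_le Z m hmS).trans ((tot_mono m hZ).trans hmS.2.le)
  · intro X hX Y hY
    -- One vector attains the minimum on both members of the chain `X ∩ Y ⊆ X ∪ Y`; modularity of
    -- its weight does the rest.
    obtain ⟨m, hmS, ⟨h1, h2⟩, -⟩ := hsim (X ∩ Y) (X ∪ Y)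
      (Finset.inter_subset_left.trans Finset.subset_union_left) (Finset.union_subset hX hY)
    have h3 := hp_le X m hmS
    have h4 := hp_le Y m hmS
    have h5 := tot_inter_add_tot_union m X Y
    omega
  · intro m hm Z hZ
    obtain ⟨m', hm', h⟩ := hp_mem Z
    exact (hm'.1 Z hZ).trans (h.le.trans (hm Z hZ))
  · obtain ⟨m, hm⟩ := hS
    exact ⟨m, hm.2, fun Z _ => hp_le Z m hm⟩
  · intro Z hZ
    obtain ⟨m, hmS, ⟨-, h⟩, ht⟩ := hsim Z Z (Finset.Subset.refl _) hZ.1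
    obtain ⟨M, hM⟩ := exists_disjoint_family_of_tight hq hmS.1 (ht hZ.ne)
    rw [h] at hM
    exact ⟨M, hM⟩

end Supermodular

end MultiDigraph

/-! ### Demands in the digraph of contracted children. -/

namespace MultiDigraph

variable {V A : Type*} [DecidableEq V] {D : MultiDigraph V A}

/-- The number of arcs of `F` with tail in `W \ U` and head in `Z`. -/
def crossIn (D : MultiDigraph V A) (F : Finset A) (W U Z : Finset V) : ℕ :=
  (F.filter fun e => D.head e ∈ Z ∧ D.tail e ∈ W ∧ D.tail e ∉ U).card

/-- The demand function of the digraph obtained from `D[W]` by contracting the members of `C`, each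
equipped with a root bound `p j`. -/
def demand (D : MultiDigraph V A) (k : ℕ) (W : Finset V) (p : Finset V → Finset V → ℤ)
    (F : Finset A) (X : Finset (Finset V)) (Z : Finset V) : ℤ :=
  ∑ j ∈ X, ((k : ℤ) - p j (Z ∩ j)) + D.crossIn F W (X.biUnion id) Z

variable {k : ℕ} {L C : Finset (Finset V)} {W : Finset V} {p : Finset V → Finset V → ℤ}
  {F : Finset A} {m : V → ℕ}

theorem IsChildren.mem_biUnion_inter (hC : IsChildren L W C) {X Y : Finset (Finset V)}
    (hX : X ⊆ C) (hY : Y ⊆ C) {v : V} :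
    v ∈ (X ∩ Y).biUnion id ↔ v ∈ X.biUnion id ∧ v ∈ Y.biUnion id := by
  simp only [Finset.mem_biUnion, Finset.mem_inter, id]
  constructor
  · rintro ⟨j, ⟨hjX, hjY⟩, hv⟩
    exact ⟨⟨j, hjX, hv⟩, ⟨j, hjY, hv⟩⟩
  · rintro ⟨⟨i, hi, hvi⟩, ⟨j, hj, hvj⟩⟩
    have := hC.eq_of_mem i (hX hi) j (hY hj) v hvi hvj
    subst this
    exact ⟨i, ⟨hi, hj⟩, hvi⟩

theorem IsChildren.inter_eq_empty (hC : IsChildren L W C) {X : Finset (Finset V)}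
    (hX : X ⊆ C) {Z : Finset V} (hZ : Z ⊆ X.biUnion id) {j : Finset V} (hj : j ∈ C) (hjX : j ∉ X) :
    Z ∩ j = ∅ := by
  by_contra hne
  obtain ⟨v, hv⟩ := Finset.nonempty_iff_ne_empty.mpr hne
  rw [Finset.mem_inter] at hv
  obtain ⟨i, hi, hvi⟩ := Finset.mem_biUnion.mp (hZ hv.1)
  exact hjX (hC.eq_of_mem i (hX hi) j hj v hvi hv.2 ▸ hi)

/-- Holds arc by arc and child by child. For a child in both `X` and `Y` it is supermodularity of `p
j`; for a child in only one of them, the other set misses it and the terms agree. -/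
theorem demand_submodular (hC : IsChildren L W C) (hp : ∀ j ∈ C, IsRootBound k j (p j))
    {X Y : Finset (Finset V)} (hX : X ⊆ C) (hY : Y ⊆ C) {Z T : Finset V}
    (hZ : Z ⊆ X.biUnion id) (hT : T ⊆ Y.biUnion id) :
    D.demand k W p F (X ∩ Y) (Z ∩ T) + D.demand k W p F (X ∪ Y) (Z ∪ T) ≤
      D.demand k W p F X Z + D.demand k W p F Y T := by
  have hcross : D.crossIn F W ((X ∩ Y).biUnion id) (Z ∩ T) +
      D.crossIn F W ((X ∪ Y).biUnion id) (Z ∪ T) ≤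
      D.crossIn F W (X.biUnion id) Z + D.crossIn F W (Y.biUnion id) T := by
    simp only [crossIn, Finset.card_filter, ← Finset.sum_add_distrib]
    refine Finset.sum_le_sum fun e _ => ?_
    simp only [hC.mem_biUnion_inter hX hY, Finset.union_biUnion, Finset.mem_union, Finset.mem_inter]
    by_cases h1 : D.head e ∈ Z <;> by_cases h2 : D.head e ∈ T <;> by_cases h3 : D.tail e ∈ W <;>
      by_cases h4 : D.tail e ∈ X.biUnion id <;> by_cases h5 : D.tail e ∈ Y.biUnion id <;>
      simp only [h1, h2, h3, h4, h5] <;> simp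
  have hconv : ∀ S ⊆ C, ∀ R : Finset V, ∑ j ∈ S, ((k : ℤ) - p j (R ∩ j)) =
      ∑ j ∈ C, if j ∈ S then (k : ℤ) - p j (R ∩ j) else 0 := by
    intro S hS R
    rw [Finset.sum_ite_mem, Finset.inter_eq_right.mpr hS]
  have hsum : ∑ j ∈ X ∩ Y, ((k : ℤ) - p j (Z ∩ T ∩ j)) + ∑ j ∈ X ∪ Y, ((k : ℤ) - p j ((Z ∪ T) ∩ j))
      ≤ ∑ j ∈ X, ((k : ℤ) - p j (Z ∩ j)) + ∑ j ∈ Y, ((k : ℤ) - p j (T ∩ j)) := by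
    rw [hconv _ (Finset.inter_subset_left.trans hX), hconv _ (Finset.union_subset hX hY),
      hconv _ hX, hconv _ hY, ← Finset.sum_add_distrib, ← Finset.sum_add_distrib]
    refine Finset.sum_le_sum fun j hj => ?_
    have hI : Z ∩ T ∩ j = (Z ∩ j) ∩ (T ∩ j) := by ext; simp
    have hU : (Z ∪ T) ∩ j = (Z ∩ j) ∪ (T ∩ j) := Finset.union_inter_distrib_right _ _ _
    rw [hI, hU]
    by_cases hjX : j ∈ X <;> by_cases hjY : j ∈ Y
    · have := (hp j hj).supermodular (Z ∩ j) Finset.inter_subset_right (T ∩ j)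
        Finset.inter_subset_right
      simp only [Finset.mem_inter, Finset.mem_union, hjX, hjY, and_self, or_self, if_true]
      omega
    · simp [hjX, hjY, hC.inter_eq_empty hY hT hj hjY]
    · simp [hjX, hjY, hC.inter_eq_empty hX hZ hj hjX]
    · simp [hjX, hjY]
  simp only [demand]
  omega

/-- `m` together with the arcs of `F` meets all demands. -/
def MeetsDemand (D : MultiDigraph V A) (k : ℕ) (W : Finset V) (C : Finset (Finset V))
    (p : Finset V → Finset V → ℤ) (F : Finset A) (m : V → ℕ) : Prop :=
  ∀ X ⊆ C, X.Nonempty → ∀ Z ⊆ X.biUnion id, (k : ℤ) ≤ D.demand k W p F X Z + tot m Z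

/-- A demand that is met with equality. -/
structure IsTightDemand (D : MultiDigraph V A) (k : ℕ) (W : Finset V) (C : Finset (Finset V))
    (p : Finset V → Finset V → ℤ) (F : Finset A) (m : V → ℕ) (X : Finset (Finset V))
    (Z : Finset V) : Prop where
  subset : X ⊆ C
  subset_biUnion : Z ⊆ X.biUnion id
  eq : D.demand k W p F X Z + tot m Z = k

theorem IsTightDemand.inter_union (hC : IsChildren L W C) (hp : ∀ j ∈ C, IsRootBound k j (p j))
    (hF : D.MeetsDemand k W C p F m) {X Y : Finset (Finset V)} {Z T : Finset V}
    (h₁ : D.IsTightDemand k W C p F m X Z) (h₂ : D.IsTightDemand k W C p F m Y T)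
    (hne : (X ∩ Y).Nonempty) :
    D.IsTightDemand k W C p F m (X ∩ Y) (Z ∩ T) ∧ D.IsTightDemand k W C p F m (X ∪ Y) (Z ∪ T) := by
  have hsub := D.demand_submodular (F := F) hC hp h₁.subset h₂.subset h₁.subset_biUnion
    h₂.subset_biUnion
  have hIC : X ∩ Y ⊆ C := Finset.inter_subset_left.trans h₁.subset
  have hUC : X ∪ Y ⊆ C := Finset.union_subset h₁.subset h₂.subset
  have hI : Z ∩ T ⊆ (X ∩ Y).biUnion id := fun v hv => by
    rw [Finset.mem_inter] at hv
    exact (hC.mem_biUnion_inter h₁.subset h₂.subset).mpr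
      ⟨h₁.subset_biUnion hv.1, h₂.subset_biUnion hv.2⟩
  have hU : Z ∪ T ⊆ (X ∪ Y).biUnion id := by
    rw [Finset.union_biUnion]
    exact Finset.union_subset_union h₁.subset_biUnion h₂.subset_biUnion
  have h3 := hF _ hIC hne _ hI
  have h4 := hF _ hUC (hne.mono (Finset.inter_subset_left.trans Finset.subset_union_left)) _ hU
  have h5 := tot_inter_add_tot_union m Z T
  have h6 := h₁.eq
  have h7 := h₂.eq
  exact ⟨⟨hIC, hI, by omega⟩, ⟨hUC, hU, by omega⟩⟩

theorem demand_singleton {j Z : Finset V} (hZ : Z ⊆ j) :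
    D.demand k W p F {j} Z = (k : ℤ) - p j Z + D.crossIn F W j Z := by
  simp [demand, Finset.inter_eq_left.mpr hZ]

theorem crossIn_add_crossIn_sdiff {U Y Z : Finset V} (h : Y ⊆ Z) :
    D.crossIn F W U Y + D.crossIn F W U (Z \ Y) = D.crossIn F W U Z := by
  simp only [crossIn, Finset.card_filter, ← Finset.sum_add_distrib]
  refine Finset.sum_congr rfl fun e _ => ?_
  by_cases h1 : D.head e ∈ Y
  · simp [h1, h h1]
  · simp [h1]

theorem tot_add_tot_sdiff {Y Z : Finset V} (h : Y ⊆ Z) :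
    tot m Y + tot m (Z \ Y) = tot m Z := by
  rw [add_comm]
  exact Finset.sum_sdiff h

variable [DecidableEq A]

/-- A minimal arc set meeting all demands provides each child with exactly `k` entering arcs and
roots. -/
theorem exists_subset_meetsDemand (hC : IsChildren L W C)
    (hp : ∀ j ∈ C, IsRootBound k j (p j)) (hm : tot m W = k) {B : Finset A}
    (hB : D.MeetsDemand k W C p B m) :
    ∃ F ⊆ B, D.MeetsDemand k W C p F m ∧
      (∀ e ∈ F, D.tail e ∈ W ∧ D.head e ∈ W ∧ ∀ j ∈ C, D.tail e ∈ j → D.head e ∉ j) ∧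
      ∀ j ∈ C, (D.crossIn F W j j : ℤ) + tot m j = k := by
  obtain ⟨F, ⟨hFB, hF⟩, hmin⟩ := (measure (Finset.card (α := A))).wf.has_min
    {F | F ⊆ B ∧ D.MeetsDemand k W C p F m} ⟨B, Finset.Subset.refl _, hB⟩
  -- Deleting `e` from the minimal `F` violates a demand; that demand was tight and `e` contributed
  -- to it.
  have hcrit : ∀ e ∈ F, ∃ X Z, X.Nonempty ∧ D.IsTightDemand k W C p F m X Z ∧
      D.head e ∈ Z ∧ D.tail e ∈ W ∧ D.tail e ∉ X.biUnion id := by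
    intro e he
    have hnot : ¬ D.MeetsDemand k W C p (F.erase e) m := fun h =>
      hmin (F.erase e) ⟨(Finset.erase_subset _ _).trans hFB, h⟩ (Finset.card_erase_lt_of_mem he)
    simp only [MeetsDemand] at hnot
    push Not at hnot
    obtain ⟨X, hX, hXne, Z, hZ, hlt⟩ := hnot
    have hle := hF X hX hXne Z hZ
    have hcr : D.crossIn F W (X.biUnion id) Z = D.crossIn (F.erase e) W (X.biUnion id) Z +
        if D.head e ∈ Z ∧ D.tail e ∈ W ∧ D.tail e ∉ X.biUnion id then 1 else 0 := by
      simp only [crossIn, Finset.card_filter]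
      exact (Finset.sum_erase_add _ _ he).symm
    simp only [demand] at hle hlt
    split_ifs at hcr with hc
    · exact ⟨X, Z, hXne, ⟨hX, hZ, by simp only [demand]; omega⟩, hc⟩
    · omega
  have hUW : ∀ {X : Finset (Finset V)} {v : V}, X ⊆ C → v ∈ X.biUnion id → v ∈ W := by
    intro X v hX hv
    obtain ⟨j, hj, hvj⟩ := Finset.mem_biUnion.mp hv
    exact (hC.ssubset j (hX hj)).1 hvj
  have hbetween : ∀ e ∈ F, D.tail e ∈ W ∧ D.head e ∈ W ∧ ∀ j ∈ C, D.tail e ∈ j → D.head e ∉ j := by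
    intro e he
    obtain ⟨X, Z, -, ht, hh, htW, htX⟩ := hcrit e he
    refine ⟨htW, hUW ht.subset (ht.subset_biUnion hh), fun j hj htj hhj => htX ?_⟩
    obtain ⟨i, hi, hhi⟩ := Finset.mem_biUnion.mp (ht.subset_biUnion hh)
    have := hC.eq_of_mem i (ht.subset hi) j hj _ hhi hhj
    subst this
    exact Finset.mem_biUnion.mpr ⟨i, hi, htj⟩
  refine ⟨F, hFB, hF, hbetween, fun j hj => ?_⟩
  have hjC : ({j} : Finset (Finset V)) ⊆ C := Finset.singleton_subset_iff.mpr hj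
  have hμ : ∀ Z ⊆ j, p j Z ≤ D.crossIn F W j Z + tot m Z := by
    intro Z hZ
    have := hF {j} hjC (by simp) Z (by simpa using hZ)
    rw [demand_singleton hZ] at this
    omega
  -- a maximal subset of `j` whose lower bound is attained
  let P : Finset (Finset V) := j.powerset.filter fun Z => D.crossIn F W j Z + tot m Z = p j Z
  have hP : ∀ {Z}, Z ∈ P ↔ Z ⊆ j ∧ D.crossIn F W j Z + tot m Z = p j Z := by simp [P]
  have hPne : ∅ ∈ P := by
    rw [hP]
    refine ⟨Finset.empty_subset _, ?_⟩
    rw [(hp j hj).empty]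
    simp [crossIn, tot]
  obtain ⟨T, -, hTmax⟩ := P.exists_le_maximal hPne
  obtain ⟨hTj, hTeq⟩ := hP.mp hTmax.1
  by_contra hne
  have hTne : T ≠ j := by
    rintro rfl
    rw [(hp T hj).self] at hTeq
    exact hne hTeq
  have hjp := hμ j (Finset.Subset.refl _)
  rw [(hp j hj).self] at hjp
  have hjW := (hC.ssubset j hj).1
  have hTt : D.IsTightDemand k W C p F m {j} T :=
    ⟨hjC, by simpa using hTj, by rw [demand_singleton hTj]; omega⟩
  -- every arc into `j \ T` lies in a tight demand that contains `T`
  have hcritT : ∀ e ∈ F, D.head e ∈ j → D.head e ∉ T → ∃ X Z, j ∈ X ∧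
      D.IsTightDemand k W C p F m X Z ∧ T ⊆ Z ∧ D.head e ∈ Z ∧ D.tail e ∉ X.biUnion id := by
    intro e he hhj hhT
    obtain ⟨X, Z, -, ht, hh, htW, htX⟩ := hcrit e he
    have hjX : j ∈ X := by
      obtain ⟨i, hi, hhi⟩ := Finset.mem_biUnion.mp (ht.subset_biUnion hh)
      exact hC.eq_of_mem i (ht.subset hi) j hj _ hhi hhj ▸ hi
    have h1 := (ht.inter_union hC hp hF hTt ⟨j, by simp [hjX]⟩).2
    have h2 : X ∪ {j} = X := by simp [hjX]
    rw [h2] at h1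
    exact ⟨X, Z ∪ T, hjX, h1, Finset.subset_union_right, Finset.mem_union_left _ hh, htX⟩
  have hexists : ∃ X Z, j ∈ X ∧ D.IsTightDemand k W C p F m X Z ∧ T ⊆ Z ∧
      ∃ v ∈ Z, v ∈ j ∧ v ∉ T := by
    by_cases harc : ∃ e ∈ F, D.head e ∈ j ∧ D.head e ∉ T
    · obtain ⟨e, he, hhj, hhT⟩ := harc
      obtain ⟨X, Z, hjX, ht, hTZ, hh, -⟩ := hcritT e he hhj hhT
      exact ⟨X, Z, hjX, ht, hTZ, _, hh, hhj, hhT⟩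
    exfalso
    push Not at harc
    have h1 : D.crossIn F W j (j \ T) = 0 := by
      rw [crossIn, Finset.card_eq_zero, Finset.filter_eq_empty_iff]
      rintro e he ⟨h', -⟩
      rw [Finset.mem_sdiff] at h'
      exact h'.2 (harc e he h'.1)
    have h2 := D.crossIn_add_crossIn_sdiff (F := F) (W := W) (U := j) hTj
    have h3 := tot_add_tot_sdiff (m := m) hTj
    have hcover : W ⊆ C.biUnion id := fun v hv => by
      obtain ⟨i, hi, hvi⟩ := hC.cover v hv
      exact Finset.mem_biUnion.mpr ⟨i, hi, hvi⟩
    have hZW : T ∪ (W \ j) ⊆ W :=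
      Finset.union_subset (hTj.trans hjW) Finset.sdiff_subset
    -- In this demand no arc crosses and only `j` has a nonzero summand, `k - p j T`. Together with
    -- `m(W) = k` it forces the supply of `j` down to `k`.
    have h4 := hF C (Finset.Subset.refl _) ⟨j, hj⟩ (T ∪ (W \ j)) (hZW.trans hcover)
    have h5 : D.crossIn F W (C.biUnion id) (T ∪ (W \ j)) = 0 := by
      rw [crossIn, Finset.card_eq_zero, Finset.filter_eq_empty_iff]
      rintro e he ⟨-, h', h''⟩
      exact h'' (hcover h')
    have h6 : ∑ i ∈ C, ((k : ℤ) - p i ((T ∪ (W \ j)) ∩ i)) = k - p j T := by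
      rw [Finset.sum_eq_single_of_mem j hj]
      · congr 2
        ext v
        simp only [Finset.mem_inter, Finset.mem_union, Finset.mem_sdiff]
        exact ⟨by tauto, fun h => ⟨Or.inl h, hTj h⟩⟩
      · intro i hi hij
        have : (T ∪ (W \ j)) ∩ i = i := by
          refine Finset.inter_eq_right.mpr fun v hv => ?_
          refine Finset.mem_union_right _ (Finset.mem_sdiff.mpr ⟨(hC.ssubset i hi).1 hv, ?_⟩)
          exact fun h => hij (hC.eq_of_mem i hi j hj v hv h)
        rw [this, (hp i hi).self]
        omega
    have h7 : tot m (T ∪ (W \ j)) + tot m (j \ T) = tot m W := by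
      have e1 : W \ (T ∪ (W \ j)) = j \ T := by
        ext v
        have := @hjW v
        simp only [Finset.mem_sdiff, Finset.mem_union]
        tauto
      rw [← tot_add_tot_sdiff hZW, e1]
    simp only [demand, h5, h6] at h4
    omega
  -- Among the tight demands that contain `T` and reach into `j \ T`, one with fewest children; it
  -- will be uncrossed into a smaller one.
  obtain ⟨⟨X, Z⟩, ⟨hjX, ht, hTZ, hv⟩, hXmin⟩ :=
    (measure fun a : Finset (Finset V) × Finset V => a.1.card).wf.has_min
      {a | j ∈ a.1 ∧ D.IsTightDemand k W C p F m a.1 a.2 ∧ T ⊆ a.2 ∧ ∃ v ∈ a.2, v ∈ j ∧ v ∉ T}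
      (by obtain ⟨X, Z, h⟩ := hexists; exact ⟨(X, Z), h⟩)
  dsimp only at hjX ht hTZ hv
  have hTZj : T ⊆ Z ∩ j := Finset.subset_inter hTZ hTj
  have hjsub : j ⊆ X.biUnion id := Finset.subset_biUnion_of_mem id hjX
  obtain ⟨e, he, hhZ, hhj, hhT, htX⟩ : ∃ e ∈ F, D.head e ∈ Z ∧ D.head e ∈ j ∧ D.head e ∉ T ∧
      D.tail e ∈ X.biUnion id := by
    by_contra hno
    push Not at hno
    -- shrinking `Z ∩ j` to `T` would violate a demand
    let Z' := (Z \ j) ∪ T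
    have hZ'Z : Z' ⊆ Z := Finset.union_subset Finset.sdiff_subset hTZ
    have hdiff : Z \ Z' = (Z ∩ j) \ T := by
      ext v
      simp only [Z', Finset.mem_sdiff, Finset.mem_union, Finset.mem_inter]
      tauto
    have h1 := hF X ht.subset ⟨j, hjX⟩ Z' (hZ'Z.trans ht.subset_biUnion)
    have h2 := ht.eq
    have h3 := D.crossIn_add_crossIn_sdiff (F := F) (W := W) (U := X.biUnion id) hZ'Z
    have h4 := tot_add_tot_sdiff (m := m) hZ'Z
    have h5 := D.crossIn_add_crossIn_sdiff (F := F) (W := W) (U := j) hTZj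
    have h6 := tot_add_tot_sdiff (m := m) hTZj
    rw [hdiff] at h3 h4
    have h7 : D.crossIn F W j ((Z ∩ j) \ T) = D.crossIn F W (X.biUnion id) ((Z ∩ j) \ T) := by
      rw [crossIn, crossIn]
      congr 1
      refine Finset.filter_congr fun e he => ?_
      simp only [Finset.mem_sdiff, Finset.mem_inter]
      constructor
      · rintro ⟨⟨⟨a, b⟩, c⟩, d, -⟩
        exact ⟨⟨⟨a, b⟩, c⟩, d, hno e he a b c⟩
      · rintro ⟨h, d, h'⟩
        exact ⟨h, d, fun h'' => h' (hjsub h'')⟩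
    have h8 : ∑ i ∈ X, ((k : ℤ) - p i (Z ∩ i)) - ∑ i ∈ X, ((k : ℤ) - p i (Z' ∩ i)) =
        p j T - p j (Z ∩ j) := by
      rw [← Finset.sum_sub_distrib, Finset.sum_eq_single_of_mem j hjX]
      · have : Z' ∩ j = T := by
          ext v
          have := @hTj v
          simp only [Z', Finset.mem_sdiff, Finset.mem_union, Finset.mem_inter]
          tauto
        rw [this]
        omega
      · intro i hi hij
        have : Z' ∩ i = Z ∩ i := by
          ext v
          have h' : v ∈ i → v ∉ j := fun h h' =>
            hij (hC.eq_of_mem i (ht.subset hi) j hj v h h')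
          have := @hTj v
          simp only [Z', Finset.mem_sdiff, Finset.mem_union, Finset.mem_inter]
          tauto
        rw [this]
        omega
    have h9 := hμ (Z ∩ j) Finset.inter_subset_right
    simp only [demand] at h1 h2
    have hmem : Z ∩ j ∈ P := hP.mpr ⟨Finset.inter_subset_right, by omega⟩
    have hsub := hTmax.2 hmem hTZj
    obtain ⟨v, hvZ, hvj, hvT⟩ := hv
    exact hvT (hsub (Finset.mem_inter.mpr ⟨hvZ, hvj⟩))
  -- The child holding the tail of `e` belongs to `X` but not to `X'`, so `X ∩ X'` is strictly
  -- smaller than `X`.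
  obtain ⟨X', Z', hjX', ht', hTZ', hhZ', htX'⟩ := hcritT e he hhj hhT
  have hI := (ht.inter_union hC hp hF ht' ⟨j, Finset.mem_inter.mpr ⟨hjX, hjX'⟩⟩).1
  refine hXmin (X ∩ X', Z ∩ Z') ⟨Finset.mem_inter.mpr ⟨hjX, hjX'⟩, hI,
    Finset.subset_inter hTZ hTZ', _, Finset.mem_inter.mpr ⟨hhZ, hhZ'⟩, hhj, hhT⟩ ?_
  obtain ⟨i, hi, hti⟩ := Finset.mem_biUnion.mp htX
  refine Finset.card_lt_card ((Finset.ssubset_iff_of_subset Finset.inter_subset_left).mpr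
    ⟨i, hi, fun h => htX' (Finset.mem_biUnion.mpr ⟨i, (Finset.mem_inter.mp h).2, hti⟩)⟩)

end MultiDigraph

/-! ### Gluing realizations of the children, and passage to `k`-arborescences. -/

namespace MultiDigraph

variable {V A : Type*} [DecidableEq V] {D : MultiDigraph V A} {k : ℕ} {L C : Finset (Finset V)}
  {W : Finset V} {p : Finset V → Finset V → ℤ} {F : Finset A} {m : V → ℕ}

/-- `m` is the root vector of an arc set `F ⊆ B` inside `W` that satisfies all cut conditions, with
equality on the members of `L` contained in `W`. -/
def Realizable (D : MultiDigraph V A) (L : Finset (Finset V)) (k : ℕ) (B : Finset A)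
    (W : Finset V) (m : V → ℕ) : Prop :=
  ∃ F ⊆ B, (∀ e ∈ F, D.tail e ∈ W ∧ D.head e ∈ W ∧ D.tail e ≠ D.head e) ∧
    (∀ Z ⊆ W, Z.Nonempty → (k : ℤ) ≤ D.inDeg F Z + tot m Z) ∧
    ∀ W' ∈ L, W' ⊆ W → (D.inDeg F W' : ℤ) + tot m W' = k

theorem tot_add_card_head (Z : Finset V) :
    tot (fun v => m v + (F.filter fun e => D.head e = v).card) Z =
      tot m Z + (F.filter fun e => D.head e ∈ Z).card := by
  have h : (F.filter fun e => D.head e ∈ Z).card = ∑ v ∈ Z, (F.filter fun e => D.head e = v).card := by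
    refine (Finset.card_eq_sum_card_fiberwise (f := D.head) (t := Z)
      (s := F.filter fun e => D.head e ∈ Z) fun e he => (Finset.mem_filter.mp he).2).trans ?_
    refine Finset.sum_congr rfl fun v hv => ?_
    rw [Finset.filter_filter]
    congr 1
    refine Finset.filter_congr fun e _ => ⟨fun h => h.2, fun h => ⟨h ▸ hv, h⟩⟩
  simp [tot, h, Finset.sum_add_distrib]

section Glue

variable [DecidableEq A]

/-- Root vectors realized in the children are combined into one of the parent. -/
theorem realizable_of_children (hC : IsChildren L W C) (hp : ∀ j ∈ C, IsRootBound k j (p j))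
    {B : Finset A} (hreal : ∀ j ∈ C, ∀ m : V → ℕ, tot m j = k → (∀ Z ⊆ j, p j Z ≤ tot m Z) →
      D.Realizable L k B j m) (hm : tot m W = k) (hB : D.MeetsDemand k W C p B m) :
    D.Realizable L k B W m := by
  obtain ⟨F, hFB, hF, hFin, hFk⟩ := exists_subset_meetsDemand hC hp hm hB
  -- Each child sees the heads of arcs of `F` as further roots.
  let μ : V → ℕ := fun v => m v + (F.filter fun e => D.head e = v).card
  have hμ : ∀ Z, tot μ Z = tot m Z + (F.filter fun e => D.head e ∈ Z).card := tot_add_card_head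
  have hcross : ∀ j ∈ C, ∀ Z ⊆ j, D.crossIn F W j Z = (F.filter fun e => D.head e ∈ Z).card := by
    intro j hj Z hZ
    rw [crossIn]
    congr 1
    refine Finset.filter_congr fun e he => ⟨fun h => h.1, fun h => ⟨h, (hFin e he).1, ?_⟩⟩
    exact fun ht => (hFin e he).2.2 j hj ht (hZ h)
  have hchild : ∀ j ∈ C, D.Realizable L k B j μ := by
    intro j hj
    refine hreal j hj μ ?_ fun Z hZ => ?_
    · rw [hμ, ← hcross j hj j (Finset.Subset.refl _), ← hFk j hj]
      omega
    · have := hF {j} (by simpa using hj) (by simp) Z (by simpa using hZ)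
      rw [demand_singleton hZ, hcross j hj Z hZ] at this
      rw [hμ]
      omega
  choose! Q hQB hQin hQcut hQL using hchild
  let G := F ∪ C.biUnion Q
  have hGW : ∀ e ∈ G, D.tail e ∈ W ∧ D.head e ∈ W ∧ D.tail e ≠ D.head e := by
    intro e he
    rcases Finset.mem_union.mp he with he | he
    · obtain ⟨h1, h2, h3⟩ := hFin e he
      refine ⟨h1, h2, fun h => ?_⟩
      obtain ⟨j, hj, hv⟩ := hC.cover _ h1
      exact h3 j hj hv (h ▸ hv)
    · obtain ⟨j, hj, he⟩ := Finset.mem_biUnion.mp he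
      have := hQin j hj e he
      have hjW := (hC.ssubset j hj).1
      exact ⟨hjW this.1, hjW this.2.1, this.2.2⟩
  have hdeg : ∀ j ∈ C, ∀ Z ⊆ j, (D.inDeg G Z : ℤ) + tot m Z = D.inDeg (Q j) Z + tot μ Z := by
    intro j hj Z hZ
    have h1 : G.filter (fun e => D.Enters e Z) =
        (F.filter fun e => D.head e ∈ Z) ∪ ((Q j).filter fun e => D.Enters e Z) := by
      ext e
      simp only [G, Finset.mem_filter, Finset.mem_union, Finset.mem_biUnion]
      constructor
      · rintro ⟨he | ⟨i, hi, he⟩, hent⟩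
        · exact Or.inl ⟨he, hent.2⟩
        · have := hC.eq_of_mem i hi j hj _ (hQin i hi e he).2.1 (hZ hent.2)
          subst this
          exact Or.inr ⟨he, hent⟩
      · rintro (⟨he, hh⟩ | ⟨he, hent⟩)
        · exact ⟨Or.inl he, fun ht => (hFin e he).2.2 j hj (hZ ht) (hZ hh), hh⟩
        · exact ⟨Or.inr ⟨j, hj, he⟩, hent⟩
    have h2 : Disjoint (F.filter fun e => D.head e ∈ Z) ((Q j).filter fun e => D.Enters e Z) := by
      refine Finset.disjoint_left.mpr fun e he he' => ?_
      have h3 := hQin j hj e (Finset.mem_filter.mp he').1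
      exact (hFin e (Finset.mem_filter.mp he).1).2.2 j hj h3.1 h3.2.1
    rw [inDeg, h1, Finset.card_union_of_disjoint h2, hμ, inDeg]
    push_cast
    ring
  have hself : ∀ j ∈ C, (D.inDeg G j : ℤ) + tot m j = k := fun j hj => by
    rw [hdeg j hj j (Finset.Subset.refl _)]
    exact hQL j hj j (hC.mem j hj) (Finset.Subset.refl _)
  refine ⟨G, Finset.union_subset hFB (Finset.biUnion_subset.mpr hQB), hGW, ?_, ?_⟩
  · intro Z hZW hZ
    let X := C.filter fun j => (Z ∩ j).Nonempty
    have hXC : X ⊆ C := Finset.filter_subset _ _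
    -- absorbing a child that meets `Z` does not increase the cut
    have habs : ∀ S ⊆ X, (D.inDeg G (Z ∪ S.biUnion id) : ℤ) + tot m (Z ∪ S.biUnion id) ≤
        D.inDeg G Z + tot m Z := by
      intro S
      induction S using Finset.induction_on with
      | empty => simp
      | insert j S _ ih =>
        intro hS
        have ih' := ih ((Finset.subset_insert _ _).trans hS)
        have hjX := Finset.mem_filter.mp (hS (Finset.mem_insert_self _ _))
        have hj := hjX.1
        let Y := Z ∪ S.biUnion id
        have hYj : (Y ∩ j).Nonempty := hjX.2.mono
          (Finset.inter_subset_inter Finset.subset_union_left (Finset.Subset.refl _))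
        -- The function `inDeg G + tot m` is submodular, at least `k` on `Y ∩ j` and equal to `k` on
        -- `j`, so it does not grow from `Y` to `Y ∪ j`.
        have h1 := hQcut j hj (Y ∩ j) Finset.inter_subset_right hYj
        rw [← hdeg j hj _ Finset.inter_subset_right] at h1
        have h2 := hself j hj
        have h3 := D.inDeg_inter_add_inDeg_union_le G Y j
        have h4 := tot_inter_add_tot_union m Y j
        have h5 : Z ∪ (insert j S).biUnion id = Y ∪ j := by
          rw [Finset.biUnion_insert, id, Finset.union_comm j, ← Finset.union_assoc]
        rw [h5]
        change (D.inDeg G Y : ℤ) + tot m Y ≤ _ at ih'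
        omega
    have hZX : Z ⊆ X.biUnion id := fun z hz => by
      obtain ⟨j, hj, hzj⟩ := hC.cover z (hZW hz)
      exact Finset.mem_biUnion.mpr
        ⟨j, Finset.mem_filter.mpr ⟨hj, z, Finset.mem_inter.mpr ⟨hz, hzj⟩⟩, hzj⟩
    have hXne : X.Nonempty := by
      obtain ⟨z, hz⟩ := hZ
      obtain ⟨j, hj, -⟩ := Finset.mem_biUnion.mp (hZX hz)
      exact ⟨j, hj⟩
    have h1 := habs X (Finset.Subset.refl _)
    rw [Finset.union_eq_right.mpr hZX] at h1
    have h2 := hF X hXC hXne (X.biUnion id) (Finset.Subset.refl _)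
    have h3 : ∑ j ∈ X, ((k : ℤ) - p j (X.biUnion id ∩ j)) = 0 := by
      refine Finset.sum_eq_zero fun j hj => ?_
      have hjU : j ⊆ X.biUnion id := Finset.subset_biUnion_of_mem id hj
      rw [Finset.inter_eq_right.mpr hjU, (hp j (hXC hj)).self]
      omega
    have h4 : D.crossIn F W (X.biUnion id) (X.biUnion id) ≤ D.inDeg G (X.biUnion id) := by
      refine Finset.card_le_card fun e he => ?_
      rw [Finset.mem_filter] at he ⊢
      exact ⟨Finset.mem_union_left _ he.1, he.2.2.2, he.2.1⟩
    rw [demand, h3] at h2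
    omega
  · intro W' hW' hW'W
    rcases hW'W.eq_or_ssubset with rfl | hlt
    · have : D.inDeg G W' = 0 := by
        rw [inDeg, Finset.card_eq_zero, Finset.filter_eq_empty_iff]
        exact fun e he hent => hent.1 (hGW e he).1
      rw [this, hm]
      simp
    · obtain ⟨j, hj, hW'j⟩ := hC.maximal W' hW' hlt
      rw [hdeg j hj W' hW'j]
      exact hQL j hj W' hW' hW'j

/-- A realizable root vector yields `k`-arborescences on all members of `L`. -/
theorem isKArborescence_induced [Fintype V] (hs : ∀ v, {v} ∈ L)
    (hF : ∀ e ∈ F, D.tail e ≠ D.head e)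
    (hcut : ∀ Z : Finset V, Z.Nonempty → (k : ℤ) ≤ D.inDeg F Z + tot m Z)
    (hL : ∀ W ∈ L, (D.inDeg F W : ℤ) + tot m W = k) {W : Finset V} (hW : W ∈ L) :
    D.IsKArborescence k W (D.induced F W) := by
  -- Arcs entering from outside `W` become roots of `F[W]`.
  let E := F.filter fun e => D.tail e ∉ W
  let μ : V → ℕ := fun v => m v + (E.filter fun e => D.head e = v).card
  have hμ : ∀ Z, ((∑ v ∈ Z, μ v : ℕ) : ℤ) = tot m Z + (E.filter fun e => D.head e ∈ Z).card :=
    fun Z => by rw [← tot_eq_natCast]; exact tot_add_card_head Z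
  have hdeg : ∀ Z ⊆ W, D.inDeg (D.induced F W) Z + (E.filter fun e => D.head e ∈ Z).card =
      D.inDeg F Z := by
    intro Z hZ
    rw [inDeg, inDeg, ← Finset.card_union_of_disjoint]
    · congr 1
      ext e
      simp only [E, induced, Finset.mem_filter, Finset.mem_union]
      simp only [Enters]
      have h1 := @hZ (D.tail e)
      have h2 := @hZ (D.head e)
      tauto
    · refine Finset.disjoint_left.mpr fun e he he' => ?_
      simp only [E, induced, Finset.mem_filter] at he he'
      exact he'.1.2 he.1.2.1
  refine isKArborescence_of_cut (m := μ) (fun e he => (Finset.mem_filter.mp he).2) ?_ ?_ ?_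
  · intro v hv
    have h1 := hL {v} (hs v)
    have h2 := hdeg {v} (by simpa using hv)
    have h3 := hμ {v}
    have h4 : ((D.induced F W).filter fun e => D.head e = v).card = D.inDeg (D.induced F W) {v} := by
      rw [inDeg]
      congr 1
      refine Finset.filter_congr fun e he => ?_
      have := hF e (Finset.mem_filter.mp he).1
      simp only [Enters, Finset.mem_singleton]
      exact ⟨fun h => ⟨fun h' => this (h'.trans h.symm), h⟩, fun h => h.2⟩
    rw [Finset.sum_singleton] at h3
    rw [h4]
    omega
  · intro Z hZ hne
    have h1 := hcut Z hne
    have h2 := hdeg Z hZ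
    have h3 := hμ Z
    omega
  · have h1 := hL W hW
    have h2 := hdeg W (Finset.Subset.refl _)
    have h3 := hμ W
    have h4 : D.inDeg (D.induced F W) W = 0 := by
      rw [inDeg, Finset.card_eq_zero, Finset.filter_eq_empty_iff]
      exact fun e he hent => hent.1 (Finset.mem_filter.mp he).2.1
    omega

end Glue

/-! ### Sums over disjoint families, and elementary bounds on demands. -/

section FamilySums

variable {q f h : Finset V → ℤ} {γ : ℕ} {M : Finset (Finset V)}

/-- Among disjoint sets with large pairwise `f`-sums, only one can contribute substantially. -/
theorem exists_sum_le (hkγ : k ≤ γ)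
    (hstar : ∀ X ⊆ W, ∀ Y ⊆ W, X.Nonempty → Y.Nonempty → Disjoint X Y → (k : ℤ) + γ ≤ f X + f Y)
    (hM : (M : Set (Finset V)).PairwiseDisjoint id)
    (hMW : ∀ T ∈ M, T ⊆ W ∧ q T ≤ k ∧ ∃ Q ⊆ T, Q.Nonempty ∧ q T ≤ k - f Q + h T)
    (hne : M.Nonempty) :
    (∃ T ∈ M, ∃ Q ⊆ T, Q.Nonempty ∧ ∑ T ∈ M, q T ≤ k - f Q + ∑ T ∈ M, h T) ∧
      (∑ T ∈ M, h T ≤ γ → ∑ T ∈ M, q T ≤ k) := by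
  have hQ : ∀ T ∈ M, ∃ Q ⊆ T, Q.Nonempty ∧ q T ≤ k - f Q + h T := fun T hT => (hMW T hT).2.2
  choose! Q hQT hQne hQq using hQ
  obtain ⟨T₀, hT₀, hmin⟩ := Finset.exists_min_image M (fun T => f (Q T)) hne
  have hpair : ∀ S ∈ M, ∀ T ∈ M, S ≠ T → (k : ℤ) + γ ≤ f (Q S) + f (Q T) := fun S hS T hT hST =>
    hstar _ ((hQT S hS).trans (hMW S hS).1) _ ((hQT T hT).trans (hMW T hT).1) (hQne S hS)
      (hQne T hT) ((hM hS hT hST).mono (hQT S hS) (hQT T hT))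
  -- `f (Q T)` is the larger of two values with sum at least `k + γ ≥ 2k`, so it is at least `k`.
  have hrest : ∀ T ∈ M.erase T₀, q T ≤ h T := by
    intro T hT
    have h1 := Finset.mem_of_mem_erase hT
    have h2 := hpair T₀ hT₀ T h1 (Finset.ne_of_mem_erase hT).symm
    have h3 := hmin T h1
    have h4 := hQq T h1
    omega
  have hq := Finset.add_sum_erase M q hT₀
  have hh := Finset.add_sum_erase M h hT₀
  have h0 := hQq T₀ hT₀
  refine ⟨⟨T₀, hT₀, Q T₀, hQT T₀ hT₀, hQne T₀ hT₀, ?_⟩, fun hγ => ?_⟩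
  · have := Finset.sum_le_sum hrest
    omega
  · rcases (M.erase T₀).eq_empty_or_nonempty with he | ⟨T₁, hT₁⟩
    · rw [he, Finset.sum_empty] at hq
      have := (hMW T₀ hT₀).2.1
      omega
    · have hT₁M := Finset.mem_of_mem_erase hT₁
      have hq1 := Finset.add_sum_erase _ q hT₁
      have hh1 := Finset.add_sum_erase _ h hT₁
      have h1 := hQq T₁ hT₁M
      have h2 := hpair T₀ hT₀ T₁ hT₁M (Finset.ne_of_mem_erase hT₁).symm
      have h3 := Finset.sum_le_sum (s := (M.erase T₀).erase T₁)
        fun T hT => hrest T (Finset.mem_of_mem_erase hT)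
      omega

end FamilySums

theorem sum_crossIn_le {U Z : Finset V} {M : Finset (Finset V)}
    (hM : (M : Set (Finset V)).PairwiseDisjoint id) (hMZ : ∀ T ∈ M, T ⊆ Z) :
    ∑ T ∈ M, D.crossIn F W U T ≤ D.crossIn F W U Z := by
  classical
  simp only [crossIn]
  rw [← Finset.card_biUnion]
  · refine Finset.card_le_card (Finset.biUnion_subset.mpr fun T hT e he => ?_)
    rw [Finset.mem_filter] at he ⊢
    exact ⟨he.1, hMZ T hT he.2.1, he.2.2⟩
  · intro S hS T hT hST
    refine Finset.disjoint_left.mpr fun e he he' => ?_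
    exact Finset.disjoint_left.mp (hM hS hT hST) (Finset.mem_filter.mp he).2.1
      (Finset.mem_filter.mp he').2.1

theorem demand_nonneg (hC : ∀ j ∈ C, IsRootBound k j (p j)) {X : Finset (Finset V)} (hX : X ⊆ C)
    (Z : Finset V) : 0 ≤ D.demand k W p F X Z := by
  refine add_nonneg (Finset.sum_nonneg fun j hj => ?_) (Int.natCast_nonneg _)
  have := (hC j (hX hj)).le (Z ∩ j) Finset.inter_subset_right
  omega

/-- The summand of `j` alone is already at least `k`, and all other terms are nonnegative. -/
theorem le_demand_of_nonpos (hC : ∀ j ∈ C, IsRootBound k j (p j)) {X : Finset (Finset V)}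
    (hX : X ⊆ C) {Z j : Finset V} (hj : j ∈ X) (hZ : p j (Z ∩ j) ≤ 0) :
    (k : ℤ) ≤ D.demand k W p F X Z := by
  have h1 : (k : ℤ) - p j (Z ∩ j) ≤ ∑ i ∈ X, ((k : ℤ) - p i (Z ∩ i)) := by
    refine Finset.single_le_sum (f := fun i => (k : ℤ) - p i (Z ∩ i)) (fun i hi => ?_) hj
    have := (hC i (hX hi)).le (Z ∩ i) Finset.inter_subset_right
    omega
  have h2 : (0 : ℤ) ≤ D.crossIn F W (X.biUnion id) Z := Int.natCast_nonneg _
  rw [demand]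
  omega

end MultiDigraph

/-! ### Realizable bounds by induction along the laminar family. -/

namespace MultiDigraph

variable {V A : Type*} [DecidableEq V] [Fintype A] [DecidableEq A] {D : MultiDigraph V A} {k : ℕ}
  {L C : Finset (Finset V)} {W : Finset V} {p : Finset V → Finset V → ℤ} {H : Finset A}

theorem f_self (L : Finset (Finset V)) (W : Finset V) : D.f L W W = 0 := by
  rw [f_eq_card_counted, Finset.card_eq_zero, Finset.filter_eq_empty_iff]
  exact fun e _ h => h.2.1.1 h.1.1

/-- `p` bounds from below the root vectors on `W` of arc sets avoiding `H`, exactly enough for all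
vectors above it to be realizable, and it is controlled by `f_W`. -/
structure IsRealizableBound (D : MultiDigraph V A) (L : Finset (Finset V)) (k : ℕ) (H : Finset A)
    (W : Finset V) (p : Finset V → ℤ) : Prop where
  bound : IsRootBound k W p
  realizable : ∀ m : V → ℕ, tot m W = k → (∀ Z ⊆ W, p Z ≤ tot m Z) →
    D.Realizable L k (Finset.univ \ H) W m
  exists_vector : ∃ m : V → ℕ, tot m W = k ∧ ∀ Z ⊆ W, p Z ≤ tot m Z
  control : ∀ Z ⊆ W, p Z ≤ 0 ∨
    ∃ Q ⊆ Z, Q.Nonempty ∧ p Z ≤ k - D.f L W Q + D.crossIn H W ∅ Z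

theorem isRealizableBound_singleton (hne : ∀ W ∈ L, W.Nonempty) (v : V) :
    D.IsRealizableBound L k H {v} fun Z => k * (Z.card : ℤ) := by
  have hsub : ∀ Z : Finset V, Z ⊆ {v} → Z.Nonempty → Z = {v} := fun Z hZ hne =>
    (Finset.subset_singleton_iff.mp hZ).resolve_left hne.ne_empty
  refine ⟨⟨by simp, by simp, ?_, ?_⟩, ?_, ⟨fun _ => k, by simp [tot], ?_⟩, ?_⟩
  · intro Z hZ
    rcases Finset.subset_singleton_iff.mp hZ with rfl | rfl <;> simp
  · intro X _ Y _
    have := Finset.card_inter_add_card_union X Y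
    rw [← mul_add, ← mul_add]
    exact_mod_cast (congrArg (k * ·) this.symm).le
  · intro m hm _
    refine ⟨∅, Finset.empty_subset _, by simp, ?_, ?_⟩
    · intro Z hZ hZne
      rw [hsub Z hZ hZne, hm]
      simp
    · intro W' hW' hW's
      rw [hsub W' hW's (hne W' hW'), hm]
      simp [inDeg]
  · intro Z _
    simp [tot, mul_comm]
  · intro Z hZ
    rcases Finset.subset_singleton_iff.mp hZ with rfl | rfl
    · simp
    · exact Or.inr ⟨{v}, Finset.Subset.refl _, by simp, by simp [f_self]⟩

/-- `f_W` is bounded by the values of the children and the arcs between them. -/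
theorem f_biUnion_le (hL : IsLaminar L) (hC : IsChildren L W C) {X : Finset (Finset V)}
    (hX : X ⊆ C) {Q : Finset V → Finset V} (hQj : ∀ j ∈ X, Q j ⊆ j) (hQne : ∀ j ∈ X, (Q j).Nonempty) :
    D.f L W (X.biUnion Q) ≤
      ∑ j ∈ X, D.f L j (Q j) + D.crossIn Finset.univ W (X.biUnion id) (X.biUnion Q) := by
  have hQ : ∀ j ∈ X, X.biUnion Q ∩ j = Q j := by
    intro j hj
    ext v
    simp only [Finset.mem_inter, Finset.mem_biUnion]
    constructor
    · rintro ⟨⟨i, hi, hv⟩, hvj⟩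
      exact hC.eq_of_mem i (hX hi) j (hX hj) v (hQj i hi hv) hvj ▸ hv
    · exact fun hv => ⟨⟨j, hj, hv⟩, hQj j hj hv⟩
  simp only [f_eq_card_counted]
  refine le_trans (Finset.card_le_card (t := (X.biUnion fun j =>
    Finset.univ.filter (D.Counted L j (Q j))) ∪ Finset.univ.filter fun e =>
      D.head e ∈ X.biUnion Q ∧ D.tail e ∈ W ∧ D.tail e ∉ X.biUnion id) ?_)
    ((Finset.card_union_le _ _).trans (Nat.add_le_add_right Finset.card_biUnion_le _))
  intro e he
  have hc := (Finset.mem_filter.mp he).2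
  obtain ⟨i, hi, hti⟩ := hC.cover _ hc.1.1
  obtain ⟨j, hjX, hhj⟩ := Finset.mem_biUnion.mp hc.2.1.2
  have hhj' := hQj j hjX hhj
  by_cases hij : i = j
  · subst hij
    rw [hC.counted_iff_of_mem hL hi hti hhj', hQ i hjX] at hc
    exact Finset.mem_union_left _ (Finset.mem_biUnion.mpr ⟨i, hjX, by simp [hc]⟩)
  · have hW := hc.1.1
    have hh := hc.2.1.2
    rw [hC.counted_iff_of_ne hi (hX hjX) hij hti hhj'] at hc
    refine Finset.mem_union_right _ (Finset.mem_filter.mpr ⟨Finset.mem_univ _, hh, hW, fun h => ?_⟩)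
    obtain ⟨l, hl, htl⟩ := Finset.mem_biUnion.mp h
    have := hC.eq_of_mem i hi l (hX hl) _ hti htl
    subst this
    obtain ⟨x, hx⟩ := hQne i hl
    exact Finset.disjoint_left.mp hc.2 (hQj i hl hx) (Finset.mem_biUnion.mpr ⟨i, hl, hx⟩)

/-- A set of unmet demand contains a set of small `f_W`-value. -/
theorem exists_sub_demand_le (hL : IsLaminar L) (hC : IsChildren L W C)
    (hp : ∀ j ∈ C, D.IsRealizableBound L k H j (p j)) {X : Finset (Finset V)} (hX : X ⊆ C)
    (hXne : X.Nonempty) {Z : Finset V} (hpos : D.demand k W p (Finset.univ \ H) X Z < k) :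
    ∃ Q ⊆ Z, Q.Nonempty ∧
      k - D.demand k W p (Finset.univ \ H) X Z ≤ (k : ℤ) - D.f L W Q + D.crossIn H W ∅ Z := by
  have hQ : ∀ j ∈ X, ∃ Q ⊆ Z ∩ j, Q.Nonempty ∧
      p j (Z ∩ j) ≤ k - D.f L j Q + D.crossIn H j ∅ (Z ∩ j) := by
    -- A child with `p j (Z ∩ j) ≤ 0` would by itself bring the demand up to `k`, so the second
    -- alternative of `control` holds for every child in `X`.
    intro j hj
    refine ((hp j (hX hj)).control (Z ∩ j) Finset.inter_subset_right).resolve_left fun h => ?_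
    exact absurd hpos (not_lt.mpr (le_demand_of_nonpos (fun i hi => (hp i hi).bound) hX hj h))
  choose! Q hQZ hQne hQp using hQ
  have hQj : ∀ j ∈ X, Q j ⊆ j := fun j hj => (hQZ j hj).trans Finset.inter_subset_right
  have hQsub : X.biUnion Q ⊆ Z :=
    Finset.biUnion_subset.mpr fun j hj => (hQZ j hj).trans Finset.inter_subset_left
  refine ⟨X.biUnion Q, hQsub, ?_, ?_⟩
  · obtain ⟨j, hj⟩ := hXne
    exact (hQne j hj).mono (Finset.subset_biUnion_of_mem Q hj)
  have h1 := D.f_biUnion_le hL hC hX hQj hQne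
  have h2 : D.crossIn Finset.univ W (X.biUnion id) (X.biUnion Q) ≤
      D.crossIn (Finset.univ \ H) W (X.biUnion id) Z + D.crossIn H W (X.biUnion id) Z := by
    simp only [crossIn]
    refine (Finset.card_le_card fun e he => ?_).trans (Finset.card_union_le _ _)
    rw [Finset.mem_filter] at he
    rw [Finset.mem_union, Finset.mem_filter, Finset.mem_filter, Finset.mem_sdiff]
    by_cases heH : e ∈ H
    · exact Or.inr ⟨heH, hQsub he.2.1, he.2.2⟩
    · exact Or.inl ⟨⟨he.1, heH⟩, hQsub he.2.1, he.2.2⟩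
  have h3 : ∑ j ∈ X, D.crossIn H j ∅ (Z ∩ j) + D.crossIn H W (X.biUnion id) Z ≤
      D.crossIn H W ∅ Z := by
    simp only [crossIn]
    rw [← Finset.card_biUnion, ← Finset.card_union_of_disjoint]
    · refine Finset.card_le_card (Finset.union_subset (Finset.biUnion_subset.mpr fun j hj e he => ?_)
        fun e he => ?_)
      · rw [Finset.mem_filter, Finset.mem_inter] at he
        exact Finset.mem_filter.mpr
          ⟨he.1, he.2.1.1, (hC.ssubset j (hX hj)).1 he.2.2.1, Finset.notMem_empty _⟩
      · rw [Finset.mem_filter] at he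
        exact Finset.mem_filter.mpr ⟨he.1, he.2.1, he.2.2.1, Finset.notMem_empty _⟩
    · refine Finset.disjoint_left.mpr fun e he he' => ?_
      obtain ⟨j, hj, he⟩ := Finset.mem_biUnion.mp he
      exact (Finset.mem_filter.mp he').2.2.2
        (Finset.mem_biUnion.mpr ⟨j, hj, (Finset.mem_filter.mp he).2.2.1⟩)
    · intro i hi j hj hij
      refine Finset.disjoint_left.mpr fun e he he' => hij ?_
      exact hC.eq_of_mem i (hX hi) j (hX hj) _ (Finset.mem_filter.mp he).2.2.1
        (Finset.mem_filter.mp he').2.2.1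
  have h4 : ∑ j ∈ X, ((D.f L j (Q j) : ℤ) - D.crossIn H j ∅ (Z ∩ j)) ≤
      ∑ j ∈ X, ((k : ℤ) - p j (Z ∩ j)) := Finset.sum_le_sum fun j hj => by
    have := hQp j hj
    omega
  rw [Finset.sum_sub_distrib] at h4
  zify at h1 h2 h3
  rw [demand]
  omega

/-- The unmet demand of a set of nodes. -/
def deficit (D : MultiDigraph V A) (k : ℕ) (W : Finset V) (C : Finset (Finset V))
    (p : Finset V → Finset V → ℤ) (B : Finset A) (Z : Finset V) : ℤ :=
  -- The empty set meets no child, and the general formula would give it the value `k`.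
  if Z = ∅ then 0 else max 0 (k - D.demand k W p B (C.filter fun j => (Z ∩ j).Nonempty) Z)

/-- If some member of `X` misses `Z`, the demand is at least `k`; otherwise `X` consists of exactly
the children meeting `Z`. So the deficit bounds the unmet demand for every choice of `X`. -/
theorem sub_demand_le_deficit (hC : IsChildren L W C) (hp : ∀ j ∈ C, IsRootBound k j (p j))
    {B : Finset A} {X : Finset (Finset V)} (hX : X ⊆ C) (hXne : X.Nonempty) {Z : Finset V}
    (hZ : Z ⊆ X.biUnion id) : k - D.demand k W p B X Z ≤ D.deficit k W C p B Z := by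
  have hempty : ∀ j ∈ X, Z ∩ j = ∅ → (k : ℤ) ≤ D.demand k W p B X Z := fun j hj h =>
    le_demand_of_nonpos hp hX hj (by rw [h, (hp j (hX hj)).empty])
  rw [deficit]
  split_ifs with h0
  · obtain ⟨j, hj⟩ := hXne
    have := hempty j hj (by simp [h0])
    omega
  · by_cases hall : ∀ j ∈ X, (Z ∩ j).Nonempty
    · have : (C.filter fun j => (Z ∩ j).Nonempty) = X := by
        ext j
        rw [Finset.mem_filter]
        refine ⟨fun h => ?_, fun h => ⟨hX h, hall j h⟩⟩
        by_contra hjX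
        exact h.2.ne_empty (hC.inter_eq_empty hX hZ h.1 hjX)
      rw [this]
      exact le_max_right _ _
    · push Not at hall
      obtain ⟨j, hj, h⟩ := hall
      have := hempty j hj h
      exact le_max_of_le_left (by omega)

/-- Where positive, the deficit is `k` minus a demand. Submodularity bounds the sum by the values at
the intersection and union of the two families of children, and `sub_demand_le_deficit` bounds those
by deficits. -/
theorem isIntersectingSupermodular_deficit (hC : IsChildren L W C)
    (hp : ∀ j ∈ C, IsRootBound k j (p j)) (B : Finset A) :
    IsIntersectingSupermodular W (D.deficit k W C p B) := by
  intro X hX Y hY hne hqX hqY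
  have hval : ∀ Z : Finset V, 0 < D.deficit k W C p B Z → D.deficit k W C p B Z =
      k - D.demand k W p B (C.filter fun j => (Z ∩ j).Nonempty) Z := by
    intro Z hZ
    rw [deficit] at hZ ⊢
    split_ifs at hZ ⊢
    · simp at hZ
    · rcases le_total (k - D.demand k W p B (C.filter fun j => (Z ∩ j).Nonempty) Z) 0 with h | h
      · rw [max_eq_left h] at hZ
        simp at hZ
      · exact max_eq_right h
  have hsub : ∀ Z : Finset V, Z ⊆ W → Z ⊆ (C.filter fun j => (Z ∩ j).Nonempty).biUnion id := by
    intro Z hZ z hz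
    obtain ⟨j, hj, hzj⟩ := hC.cover z (hZ hz)
    exact Finset.mem_biUnion.mpr
      ⟨j, Finset.mem_filter.mpr ⟨hj, z, Finset.mem_inter.mpr ⟨hz, hzj⟩⟩, hzj⟩
  rw [hval X hqX, hval Y hqY]
  set P := C.filter fun j => (X ∩ j).Nonempty
  set R := C.filter fun j => (Y ∩ j).Nonempty
  have hPC : P ⊆ C := Finset.filter_subset _ _
  have hRC : R ⊆ C := Finset.filter_subset _ _
  have hXP := hsub X hX
  have hYR := hsub Y hY
  have h1 := D.demand_submodular (F := B) hC hp hPC hRC hXP hYR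
  obtain ⟨z, hz⟩ := hne
  have hzm := Finset.mem_inter.mp hz
  have hI : X ∩ Y ⊆ (P ∩ R).biUnion id := fun v hv =>
    (hC.mem_biUnion_inter hPC hRC).mpr
      ⟨hXP (Finset.mem_inter.mp hv).1, hYR (Finset.mem_inter.mp hv).2⟩
  have hPR : (P ∩ R).Nonempty := by
    obtain ⟨j, hj, -⟩ := Finset.mem_biUnion.mp (hI hz)
    exact ⟨j, hj⟩
  have h2 := D.sub_demand_le_deficit (B := B) hC hp (Finset.inter_subset_left.trans hPC) hPR hI
  have h3 := D.sub_demand_le_deficit (B := B) hC hp (Finset.union_subset hPC hRC)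
    (hPR.mono (Finset.inter_subset_left.trans Finset.subset_union_left))
    (Z := X ∪ Y) (by rw [Finset.union_biUnion]; exact Finset.union_subset_union hXP hYR)
  omega

/-- If the values of `f` at disjoint sets are large, every member of the laminar family has a
realizable bound after the deletion of few arcs. -/
theorem exists_isRealizableBound {γ : ℕ} (hL : IsLaminar L) (hs : ∀ v, {v} ∈ L)
    (hne : ∀ W ∈ L, W.Nonempty) (hkγ : k ≤ γ) (hH : H.card ≤ γ)
    (hstar : ∀ W ∈ L, ∀ X ⊆ W, ∀ Y ⊆ W, X.Nonempty → Y.Nonempty → Disjoint X Y →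
      k + γ ≤ D.f L W X + D.f L W Y) {W : Finset V} (hW : W ∈ L) :
    ∃ p, D.IsRealizableBound L k H W p := by
  induction hn : W.card using Nat.strong_induction_on generalizing W with
  | _ n ih =>
    subst hn
    have hW0 := Finset.card_pos.mpr (hne W hW)
    rcases Nat.lt_or_ge W.card 2 with h1 | h2
    · obtain ⟨v, rfl⟩ := Finset.card_eq_one.mp (show W.card = 1 by omega)
      exact ⟨_, isRealizableBound_singleton hne v⟩
    obtain ⟨C, hC⟩ := exists_isChildren hL hs h2
    have hchild : ∀ j ∈ C, ∃ p, D.IsRealizableBound L k H j p := fun j hj =>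
      ih j.card (Finset.card_lt_card (hC.ssubset j hj)) (hC.mem j hj) rfl
    choose! p hp using hchild
    have hpb : ∀ j ∈ C, IsRootBound k j (p j) := fun j hj => (hp j hj).bound
    let B := Finset.univ \ H
    let q := D.deficit k W C p B
    have hXC : ∀ Z : Finset V, (C.filter fun j => (Z ∩ j).Nonempty) ⊆ C :=
      fun Z => Finset.filter_subset _ _
    have hqk : ∀ Z, q Z ≤ k := by
      intro Z
      simp only [q, deficit]
      split_ifs
      · omega
      · have := D.demand_nonneg (W := W) (F := B) hpb (hXC Z) Z
        exact max_le (by omega) (by omega)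
    have hctl : ∀ T ⊆ W, 0 < q T →
        ∃ Q ⊆ T, Q.Nonempty ∧ q T ≤ k - D.f L W Q + D.crossIn H W ∅ T := by
      intro T hT hqT
      simp only [q, deficit] at hqT ⊢
      split_ifs at hqT ⊢ with h0
      · simp at hqT
      · have hpos : 0 < (k : ℤ) - D.demand k W p B (C.filter fun j => (T ∩ j).Nonempty) T := by
          rcases lt_max_iff.mp hqT with h | h
          · simp at h
          · exact h
        rw [max_eq_right hpos.le]
        refine exists_sub_demand_le hL hC hp (hXC T) ?_ (sub_pos.mp hpos)
        obtain ⟨z, hz⟩ := Finset.nonempty_iff_ne_empty.mpr h0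
        obtain ⟨j, hj, hzj⟩ := hC.cover z (hT hz)
        exact ⟨j, Finset.mem_filter.mpr ⟨hj, z, Finset.mem_inter.mpr ⟨hz, hzj⟩⟩⟩
    have hstar' : ∀ X ⊆ W, ∀ Y ⊆ W, X.Nonempty → Y.Nonempty → Disjoint X Y →
        (k : ℤ) + γ ≤ D.f L W X + D.f L W Y := fun X hX Y hY hX' hY' hd => by
      exact_mod_cast hstar W hW X hX Y hY hX' hY' hd
    have hHle : ∀ Z, D.crossIn H W ∅ Z ≤ γ := fun Z => (Finset.card_filter_le _ _).trans hH
    obtain ⟨P, hP, hPq, hPex, hPfam⟩ := exists_isRootBound (k := k) (q := q) (hne W hW)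
      (by simp [q, deficit]) (fun Z _ => hqk Z)
      (isIntersectingSupermodular_deficit hC hpb B) (by
        intro M hM hMd
        rcases M.eq_empty_or_nonempty with rfl | hMne
        · simp
        refine (exists_sum_le (f := fun Z => (D.f L W Z : ℤ))
          (h := fun Z => (D.crossIn H W ∅ Z : ℤ)) hkγ hstar' hMd
          (fun T hT => ⟨(hM T hT).1, hqk T, hctl T (hM T hT).1 (hM T hT).2⟩) hMne).2 ?_
        exact_mod_cast (sum_crossIn_le hMd fun T hT => (hM T hT).1).trans (hHle W))
    refine ⟨P, hP, ?_, hPex, ?_⟩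
    · intro m hm hPm
      refine realizable_of_children hC hpb (fun j hj => (hp j hj).realizable) hm ?_
      intro X hX hXne Z hZ
      have hZW : Z ⊆ W := hZ.trans
        (Finset.biUnion_subset.mpr fun j hj => (hC.ssubset j (hX hj)).1)
      have h3 := hPq m hPm Z hZW
      have h4 := D.sub_demand_le_deficit (B := B) hC hpb hX hXne hZ
      change D.deficit k W C p B Z ≤ _ at h3
      change (k : ℤ) ≤ D.demand k W p B X Z + _
      omega
    · intro Z hZ
      -- The whole set is controlled by `Q = W`, where `f_W` vanishes. On a proper subset, `P` is a
      -- sum of deficits of disjoint sets.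
      rcases hZ.eq_or_ssubset with rfl | hlt
      · refine Or.inr ⟨Z, Finset.Subset.refl _, hne Z hW, ?_⟩
        rw [hP.self, f_self]
        simp
      obtain ⟨M, hM, hMd, hMs⟩ := hPfam Z hlt
      rcases M.eq_empty_or_nonempty with rfl | hMne
      · left
        simp [hMs]
      right
      obtain ⟨T, hT, Q, hQT, hQne, hle⟩ := (exists_sum_le (f := fun Z => (D.f L W Z : ℤ))
          (h := fun Z => (D.crossIn H W ∅ Z : ℤ)) hkγ hstar' hMd
          (fun T hT => ⟨(hM T hT).2.2, hqk T, hctl T (hM T hT).2.2 (hM T hT).2.1⟩) hMne).1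
      refine ⟨Q, hQT.trans (hM T hT).1, hQne, ?_⟩
      have h3 := D.sum_crossIn_le (F := H) (W := W) (U := ∅) hMd fun T hT => (hM T hT).1
      zify at h3
      rw [hMs]
      omega

/-- If the values of `f` at disjoint sets are large, a tight `k`-arborescence avoids `H`. -/
theorem exists_isTight_disjoint [Fintype V] {γ : ℕ} (hL : IsLaminar L) (hV : Finset.univ ∈ L)
    (hne : ∀ W ∈ L, W.Nonempty) (hkγ : k ≤ γ) (hH : H.card ≤ γ)
    (hstar : ∀ W ∈ L, ∀ X ⊆ W, ∀ Y ⊆ W, X.Nonempty → Y.Nonempty → Disjoint X Y →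
      k + γ ≤ D.f L W X + D.f L W Y) :
    ∃ F, D.IsTight L k F ∧ Disjoint F H := by
  have hne' : ∀ W ∈ withSingletons L, W.Nonempty := fun W hW => by
    rcases mem_withSingletons.mp hW with hW | ⟨v, rfl⟩
    · exact hne W hW
    · simp
  obtain ⟨p, hp⟩ := D.exists_isRealizableBound (H := H) (isLaminar_withSingletons hL)
    singleton_mem_withSingletons hne' hkγ hH (by
      intro W hW X hX Y hY hXne hYne hd
      rw [f_withSingletons, f_withSingletons]
      rcases mem_withSingletons.mp hW with hW | ⟨v, rfl⟩
      · exact hstar W hW X hX Y hY hXne hYne hd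
      · have h1 := (Finset.subset_singleton_iff.mp hX).resolve_left hXne.ne_empty
        have h2 := (Finset.subset_singleton_iff.mp hY).resolve_left hYne.ne_empty
        simp [h1, h2] at hd) (subset_withSingletons hV)
  obtain ⟨m, hm, hpm⟩ := hp.exists_vector
  obtain ⟨F, hFB, hFin, hcut, htight⟩ := hp.realizable m hm hpm
  have hall : ∀ W ∈ L, D.IsKArborescence k W (D.induced F W) := fun W hW =>
    isKArborescence_induced singleton_mem_withSingletons (fun e he => (hFin e he).2.2)
      (fun Z hZ => hcut Z (Finset.subset_univ Z) hZ)
      (fun W hW => htight W hW (Finset.subset_univ W)) (subset_withSingletons hW)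
  refine ⟨F, ⟨?_, hall⟩, ?_⟩
  · have := hall _ hV
    simpa [induced] using this
  · exact Finset.disjoint_left.mpr fun e he => (Finset.mem_sdiff.mp (hFB he)).2

end MultiDigraph

theorem mainTheorem1 {V A : Type*} [Fintype V] [DecidableEq V] [Fintype A] [DecidableEq A]
    (D : MultiDigraph V A) (L : Finset (Finset V)) (hL : IsLaminar L) (hV : Finset.univ ∈ L)
    (k : ℕ) (hk : 0 < k) (hex : ∃ F : Finset A, D.IsTight L k F)
    (γ : ℕ) (hγ : IsLeast {n : ℕ | ∃ H : Finset A, D.IsTransversal L k H ∧ H.card = n} γ)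
    (hkγ : k ≤ γ) :
    IsLeast {x : ℤ | ∃ W ∈ L, ∃ Z₁ Z₂ : Finset V, Z₁.Nonempty ∧ Z₂.Nonempty ∧
      Z₁ ⊆ W ∧ Z₂ ⊆ W ∧ Disjoint Z₁ Z₂ ∧
      x = (D.f L W Z₁ : ℤ) + (D.f L W Z₂ : ℤ) - (k : ℤ) + 1} (γ : ℤ) := by
  have hupper : ∀ W ∈ L, ∀ Z₁ ⊆ W, ∀ Z₂ ⊆ W, Z₁.Nonempty → Z₂.Nonempty → Disjoint Z₁ Z₂ →
      γ + k ≤ D.f L W Z₁ + D.f L W Z₂ + 1 := by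
    intro W hW Z₁ h₁W Z₂ h₂W h₁ h₂ hd
    obtain ⟨H, hH, hcard⟩ := MultiDigraph.exists_isTransversal hL hk hex hW h₁ h₂ h₁W h₂W hd
    have := hγ.2 ⟨H, hH, rfl⟩
    omega
  constructor
  · by_contra hnot
    obtain ⟨⟨H, hH, hcard⟩, -⟩ := hγ
    -- On an empty member the arc count would read `|F[∅]| + k = 0`, impossible for positive `k`.
    have hne : ∀ W ∈ L, W.Nonempty := by
      intro W hW
      obtain ⟨F, hF⟩ := hex
      have := (hF.2 W hW).card_add
      rw [Finset.nonempty_iff_ne_empty]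
      rintro rfl
      simp at this
      omega
    -- If the value `γ` is never attained, integrality sharpens the upper bound by one to `k + γ ≤
    -- f_W(X) + f_W(Y)`. Then a tight `k`-arborescence avoids the minimum transversal `H`.
    obtain ⟨F, hF, hd⟩ := MultiDigraph.exists_isTight_disjoint (D := D) (H := H) hL hV hne hkγ hcard.le (by
      intro W hW X hX Y hY hXne hYne hdis
      have h1 := hupper W hW X hX Y hY hXne hYne hdis
      have h2 : (γ : ℤ) ≠ (D.f L W X : ℤ) + (D.f L W Y : ℤ) - (k : ℤ) + 1 := fun h =>
        hnot ⟨W, hW, X, Y, hXne, hYne, hX, hY, hdis, h⟩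
      omega)
    obtain ⟨e, he⟩ := hH F hF
    rw [Finset.mem_inter] at he
    exact Finset.disjoint_left.mp hd he.1 he.2
  · rintro x ⟨W, hW, Z₁, Z₂, h₁, h₂, h₁W, h₂W, hd, rfl⟩
    have := hupper W hW Z₁ h₁W Z₂ h₂W h₁ h₂ hd
    omega
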